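/- Let $n \ge 2$ be even. Let $T^*S^n = \{(u,v) \in \mathbb{R}^{n+1}\times\mathbb{R}^{n+1} : |u| = 1,\ \langle u,v\rangle = 0\}$, regarded as the interior of the closed disc bundle $D^*(S^n) = \{(u,v) : |u|=1,\ \langle u,v\rangle = 0,\ |v|\le 1\}$ via $(u,v)\mapsto (u, v/\sqrt{1+|v|^2})$. Fix $p\in S^n$, let $D \subset D^*(S^n)$ be the closed disc fibre over $p$ and $B = \partial D \cong S^{n-1}$. Let $\mathrm{hAut}_c(T^*S^n)$ be the space of homotopy equivalences $T^*S^n \to T^*S^n$ which are the identity outside a compact set, so that $\pi_0(\mathrm{hAut}_c(T^*S^n))$ is the set of its elements up to compactly supported homotopy. Extending maps by the identity on $\partial D^*(S^n)$, $\pi_0(\mathrm{hAut}_c(T^*S^n))$ acts on $H_n(D^*(S^n), B;\mathbb{Z})$. Orient $S^n$, and let $[S^n] \in H_n(D^*(S^n), B;\mathbb{Z})$ be the class of the zero section. Orient $T^*S^n$ by its symplectic structure (equivalently, as the complex affine quadric $\{z\in\mathbb{C}^{n+1} : \sum_j z_j^2 = 1\}$), so that $\langle [S^n],[S^n]\rangle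 = 2(-1)^{n/2}$, and orient $D$ so that its intersection number with the zero section is $\langle [D],[S^n]\rangle = 1$; equivalently, $D$ carries $(-1)^{n/2}$ times the orientation of $T_pS^n$. Let $[D] \in H_n(D^*(S^n), B;\mathbb{Z})$ be the resulting class of the fibre. Then $\{[S^n],[D]\}$ is a basis of the free abelian group $H_n(D^*(S^n), B;\mathbb{Z})$, and every element of $\pi_0(\mathrm{hAut}_c(T^*S^n))$ acts on $H_n(D^*(S^n), B;\mathbb{Z})$, in terms of this basis, either as the identity or as $$\begin{pmatrix} -1 & (-1)^{\frac n2+1} \\ 0 & 1\end{pmatrix}$$ (the columns being the images of $[S^n]$ and $[D]$). -/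

import Mathlib

open CategoryTheory CategoryTheory.Limits

noncomputable section

namespace CotSphere

/-! ### Singular homology of pairs, with integer coefficients -/

/-- Singular chains with integer coefficients. -/
abbrev chains : TopCat.{0} ⥤ ChainComplex (ModuleCat.{0} ℤ) ℕ :=
  (AlgebraicTopology.singularChainComplexFunctor (ModuleCat.{0} ℤ)).obj (ModuleCat.of ℤ ℤ)

/-- Absolute singular homology `H_n(X; ℤ)`. -/
abbrev absHomology (n : ℕ) : TopCat.{0} ⥤ ModuleCat.{0} ℤ :=
  (AlgebraicTopology.singularHomologyFunctor (ModuleCat.{0} ℤ) n).obj (ModuleCat.of ℤ ℤ)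

/-- Relative singular chains `C_*(X, A) = C_*(X) / C_*(A)`. -/
def relChains : TopPair.{0} ⥤ ChainComplex (ModuleCat.{0} ℤ) ℕ where
  obj P := cokernel (chains.map P.map)
  map {P Q} f := cokernel.map _ _ (chains.map (TopPair.Hom.snd f)) (chains.map (TopPair.Hom.fst f))
    (by rw [← Functor.map_comp, ← Functor.map_comp, TopPair.Hom.w])
  map_id P := by
    rw [← cancel_epi (cokernel.π _)]
    have : chains.map (TopPair.Hom.fst (𝟙 P)) = 𝟙 _ := chains.map_id _
    simp [cokernel.map, this]
  map_comp f g := by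
    rw [← cancel_epi (cokernel.π _)]
    have : chains.map (TopPair.Hom.fst (f ≫ g)) =
        chains.map (TopPair.Hom.fst f) ≫ chains.map (TopPair.Hom.fst g) := chains.map_comp _ _
    simp [cokernel.map, this]

/-- The projection `C_*(X) ⟶ C_*(X, A)`. -/
def toRelChains (P : TopPair.{0}) : chains.obj P.fst ⟶ relChains.obj P :=
  cokernel.π (chains.map P.map)

/-- Relative singular homology `H_n(X, A; ℤ)`. -/
def relHomology (n : ℕ) : TopPair.{0} ⥤ ModuleCat.{0} ℤ :=
  relChains ⋙ HomologicalComplex.homologyFunctor _ _ n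

/-- The canonical map `H_n(X; ℤ) ⟶ H_n(X, A; ℤ)`. -/
def absToRel (n : ℕ) (P : TopPair.{0}) : (absHomology n).obj P.fst ⟶ (relHomology n).obj P :=
  (HomologicalComplex.homologyFunctor _ _ n).map (toRelChains P)

/-- The short exact sequence `0 → C_*(A) → C_*(X) → C_*(X, A) → 0`. -/
def pairSeq (P : TopPair.{0}) : ShortComplex (ChainComplex (ModuleCat.{0} ℤ) ℕ) :=
  ShortComplex.mk (chains.map P.map) (toRelChains P) (cokernel.condition _)

lemma pairSeq_shortExact (P : TopPair.{0}) : (pairSeq P).ShortExact := by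
  have hm : Mono P.map := (TopCat.mono_iff_injective _).2 P.isEmbedding_map.injective
  have : Mono (pairSeq P).f := by dsimp [pairSeq]; infer_instance
  have : Epi (pairSeq P).g := coequalizer.π_epi
  exact ⟨ShortComplex.exact_of_g_is_cokernel _ (cokernelIsCokernel _)⟩

def pairSeqMap {P Q : TopPair.{0}} (f : P ⟶ Q) : pairSeq P ⟶ pairSeq Q where
  τ₁ := chains.map (TopPair.Hom.snd f)
  τ₂ := chains.map (TopPair.Hom.fst f)
  τ₃ := relChains.map f
  comm₁₂ := by
    dsimp [pairSeq]; rw [← Functor.map_comp, ← Functor.map_comp, TopPair.Hom.w]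
  comm₂₃ := by
    simp [pairSeq, relChains, toRelChains, cokernel.map]

/-- A homotopy equivalence of spaces is a quasi-isomorphism on singular chains. -/
lemma quasiIso_of_homotopyInverse {X Y : TopCat.{0}} (f : X ⟶ Y) (g : Y ⟶ X)
    (h : TopCat.Homotopy (f ≫ g) (𝟙 X)) (h' : TopCat.Homotopy (g ≫ f) (𝟙 Y)) :
    QuasiIso (chains.map f) := by
  rw [quasiIso_iff]
  intro i
  rw [quasiIsoAt_iff_isIso_homologyMap]
  refine ⟨HomologicalComplex.homologyMap (chains.map g) i, ?_, ?_⟩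
  · rw [← HomologicalComplex.homologyMap_comp, ← Functor.map_comp]
    simpa using h.congr_homologyMap_singularChainComplexFunctor (ModuleCat.of ℤ ℤ) i
  · rw [← HomologicalComplex.homologyMap_comp, ← Functor.map_comp]
    simpa using h'.congr_homologyMap_singularChainComplexFunctor (ModuleCat.of ℤ ℤ) i

/-- The cylinder `(X × [0,1], A × [0,1])` of a pair. -/
def cyl (P : TopPair.{0}) : TopPair.{0} :=
  TopPair.of (A := TopCat.of (P.snd × unitInterval)) (X := TopCat.of (P.fst × unitInterval))
    (TopCat.ofHom (P.map.hom.prodMap (ContinuousMap.id _)))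
    (P.isEmbedding_map.prodMap Topology.IsEmbedding.id)

def cylProjTop (X : TopCat.{0}) : TopCat.of (X × unitInterval) ⟶ X :=
  TopCat.ofHom ⟨Prod.fst, continuous_fst⟩

def cylInclTop (X : TopCat.{0}) (t : unitInterval) : X ⟶ TopCat.of (X × unitInterval) :=
  TopCat.ofHom ⟨fun x => (x, t), by fun_prop⟩

def cylProj (P : TopPair.{0}) : cyl P ⟶ P :=
  TopPair.ofHom (X := cyl P) (Y := P) (cylProjTop P.fst) (cylProjTop P.snd) rfl

def cylIncl (P : TopPair.{0}) (t : unitInterval) : P ⟶ cyl P :=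
  TopPair.ofHom (X := P) (Y := cyl P) (cylInclTop P.fst t) (cylInclTop P.snd t) rfl

lemma quasiIso_cylProjTop (X : TopCat.{0}) : QuasiIso (chains.map (cylProjTop X)) := by
  refine quasiIso_of_homotopyInverse _ (cylInclTop X 0) ?_ ?_
  · exact
      { toFun := fun q => (q.2.1, q.1 * q.2.2)
        continuous_toFun := by fun_prop
        map_zero_left := fun x => Prod.ext rfl (zero_mul _)
        map_one_left := fun x => Prod.ext rfl (one_mul _) }
  · exact ContinuousMap.Homotopy.refl _

/-- Homotopic maps of pairs induce the same map in relative homology. -/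
lemma relHomology_map_eq (n : ℕ) {P Q : TopPair.{0}} (H : cyl P ⟶ Q) :
    (relHomology n).map (cylIncl P 0 ≫ H) = (relHomology n).map (cylIncl P 1 ≫ H) := by
  have hq : QuasiIso (relChains.map (cylProj P)) :=
    HomologicalComplex.HomologySequence.quasiIso_τ₃ (pairSeqMap (cylProj P))
      (pairSeq_shortExact _) (pairSeq_shortExact _)
      (quasiIso_cylProjTop _) (quasiIso_cylProjTop _)
  have hi : IsIso ((relHomology n).map (cylProj P)) := by
    have := (quasiIsoAt_iff_isIso_homologyMap (relChains.map (cylProj P)) n).1 inferInstance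
    exact this
  have key : (relHomology n).map (cylIncl P 0) = (relHomology n).map (cylIncl P 1) := by
    rw [← cancel_mono ((relHomology n).map (cylProj P)), ← Functor.map_comp, ← Functor.map_comp]
    rfl
  rw [Functor.map_comp, Functor.map_comp, key]

/-! ### The cotangent bundle of the sphere and its disc bundle -/

/-- The ambient Euclidean space `ℝ^{n+1}`. -/
abbrev E (n : ℕ) := EuclideanSpace ℝ (Fin (n + 1))

/-- The unit sphere `S^n ⊆ ℝ^{n+1}`. -/
abbrev S (n : ℕ) := {u : E n // ‖u‖ = 1}

/-- `T^*S^n = {(u, v) : |u| = 1, ⟨u, v⟩ = 0}`. -/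
abbrev T (n : ℕ) := {x : E n × E n // ‖x.1‖ = 1 ∧ inner ℝ x.1 x.2 = 0}

/-- The closed unit disc bundle `D^*(S^n) = {(u, v) : |u| = 1, ⟨u, v⟩ = 0, |v| ≤ 1}`. -/
abbrev D (n : ℕ) := {x : E n × E n // ‖x.1‖ = 1 ∧ inner ℝ x.1 x.2 = 0 ∧ ‖x.2‖ ≤ 1}

variable {n : ℕ}

/-- The identification of `T^*S^n` with the interior of `D^*(S^n)`,
`(u, v) ↦ (u, v / √(1 + |v|²))`. -/
def toDisc (x : T n) : D n :=
  ⟨(x.1.1, (√(1 + ‖x.1.2‖ ^ 2))⁻¹ • x.1.2), x.2.1, by rw [inner_smul_right, x.2.2, mul_zero], by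
    have := (Homeomorph.unitBall x.1.2).2
    rw [mem_ball_zero_iff] at this
    exact this.le⟩

/-- On the interior `|v| < 1` of `D^*(S^n)` this is the inverse
`(u, v) ↦ (u, v / √(1 - |v|²))` of `toDisc`. -/
def ofDisc (x : D n) : T n :=
  ⟨(x.1.1, (√(1 - ‖x.1.2‖ ^ 2))⁻¹ • x.1.2), x.2.1, by rw [inner_smul_right, x.2.2.1, mul_zero]⟩

lemma norm_toDisc (x : T n) : ‖(toDisc x).1.2‖ < 1 := by
  have := (Homeomorph.unitBall x.1.2).2
  rwa [mem_ball_zero_iff] at this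

lemma toDisc_ofDisc (x : D n) (hx : ‖x.1.2‖ < 1) : toDisc (ofDisc x) = x := by
  apply Subtype.ext
  refine Prod.ext rfl ?_
  exact OpenPartialHomeomorph.univUnitBall.right_inv (x := x.1.2)
    (by simpa [OpenPartialHomeomorph.univUnitBall] using hx)

lemma ofDisc_toDisc (x : T n) : ofDisc (toDisc x) = x := by
  apply Subtype.ext
  refine Prod.ext rfl ?_
  exact OpenPartialHomeomorph.univUnitBall.left_inv (x := x.1.2)
    (by simp [OpenPartialHomeomorph.univUnitBall])

lemma continuous_toDisc : Continuous (toDisc (n := n)) := by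
  unfold toDisc
  refine Continuous.subtype_mk (Continuous.prodMk (by fun_prop) ?_) _
  refine Continuous.smul (f := fun x : T n => (√(1 + ‖x.1.2‖ ^ 2))⁻¹) (g := fun x => x.1.2)
    (Continuous.inv₀ (by fun_prop) fun x => ?_) (by fun_prop)
  positivity

lemma continuousOn_ofDisc : ContinuousOn (ofDisc (n := n)) {x | ‖x.1.2‖ < 1} := by
  refine Topology.IsInducing.subtypeVal.continuousOn_iff.2 ?_
  refine ContinuousOn.prodMk (f := fun x : D n => x.1.1)
    (g := fun x : D n => (√(1 - ‖x.1.2‖ ^ 2))⁻¹ • x.1.2) (by fun_prop) ?_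
  refine ContinuousOn.smul (f := fun x : D n => (√(1 - ‖x.1.2‖ ^ 2))⁻¹) (g := fun x => x.1.2)
    (ContinuousOn.inv₀ (by fun_prop) fun x hx => ?_) (by fun_prop)
  have hx : ‖x.1.2‖ < 1 := hx
  have : 0 < 1 - ‖x.1.2‖ ^ 2 := by nlinarith [norm_nonneg x.1.2]
  positivity

/-! ### Compactly supported homotopy automorphisms -/

/-- A self-map is compactly supported if it is the identity outside a compact set. -/
def IsCompactlySupported {X : Type} [TopologicalSpace X] (f : C(X, X)) : Prop :=
  ∃ K : Set X, IsCompact K ∧ ∀ x ∉ K, f x = x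

/-- `hAut_c(T^*S^n)`: the compactly supported self-maps of `T^*S^n` that are homotopy
equivalences. -/
structure HAutC (n : ℕ) : Type where
  toMap : C(T n, T n)
  compactSupport : IsCompactlySupported toMap
  homotopyEquiv : ∃ e : ContinuousMap.HomotopyEquiv (T n) (T n), e.toFun = toMap

/-- Being joined by a compactly supported homotopy: a homotopy which is constant (that is, equal to
the identity, after enlarging `K`) outside a compact set `K`. Every stage of such a homotopy
between elements of `hAut_c` lies in `hAut_c`. -/
def CSHomotopic (f g : HAutC n) : Prop :=
  ∃ K : Set (T n), IsCompact K ∧ ContinuousMap.HomotopicRel f.toMap g.toMap Kᶜ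

instance hAutCSetoid (n : ℕ) : Setoid (HAutC n) where
  r := CSHomotopic
  iseqv :=
    { refl := fun f => ⟨∅, isCompact_empty, ContinuousMap.HomotopicRel.refl _⟩
      symm := fun ⟨K, hK, h⟩ => ⟨K, hK, h.symm⟩
      trans := fun ⟨K, hK, ⟨h⟩⟩ ⟨L, hL, ⟨h'⟩⟩ => ⟨K ∪ L, hK.union hL, by
        have a : ∀ x ∈ (K ∪ L)ᶜ, x ∈ Kᶜ := fun x hx hk => hx (Or.inl hk)
        have b : ∀ x ∈ (K ∪ L)ᶜ, x ∈ Lᶜ := fun x hx hk => hx (Or.inr hk)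
        exact ContinuousMap.HomotopicRel.trans
          ⟨⟨h.toHomotopy, fun t x hx => h.prop' t x (a x hx)⟩⟩
          ⟨⟨h'.toHomotopy, fun t x hx => h'.prop' t x (b x hx)⟩⟩⟩ }

/-- `π_0(hAut_c(T^*S^n))`. -/
def PiZeroHAutC (n : ℕ) : Type := Quotient (hAutCSetoid n)

/-! ### Extension to the closed disc bundle -/

/-- Extension of a self-map of `T^*S^n` to `D^*(S^n)` by the identity on the boundary. -/
def extFun (f : T n → T n) (x : D n) : D n :=
  open Classical in if ‖x.1.2‖ < 1 then toDisc (f (ofDisc x)) else x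

lemma continuous_extFun {Y : Type} [TopologicalSpace Y] (F : Y → T n → T n)
    (hF : Continuous fun q : Y × T n => F q.1 q.2) (K : Set (T n)) (hK : IsCompact K)
    (h : ∀ y, ∀ x ∉ K, F y x = x) : Continuous fun q : Y × D n => extFun (F q.1) q.2 := by
  have hU : IsOpen {q : Y × D n | ‖q.2.1.2‖ < 1} := isOpen_lt (by fun_prop) continuous_const
  have hV : IsOpen {q : Y × D n | q.2 ∉ toDisc '' K} :=
    (hK.image continuous_toDisc).isClosed.isOpen_compl.preimage continuous_snd
  rw [continuous_iff_continuousAt]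
  intro q
  by_cases hq : ‖q.2.1.2‖ < 1
  · refine ContinuousOn.continuousAt ?_ (hU.mem_nhds hq)
    have : ContinuousOn (fun q : Y × D n => toDisc (F q.1 (ofDisc q.2)))
        {q : Y × D n | ‖q.2.1.2‖ < 1} := by
      refine continuous_toDisc.comp_continuousOn ?_
      refine hF.comp_continuousOn (f := fun q : Y × D n => (q.1, ofDisc q.2)) ?_
      exact continuousOn_fst.prodMk
        (continuousOn_ofDisc.comp continuousOn_snd fun q hq => hq)
    exact this.congr fun q hq => if_pos hq
  · have hq' : q.2 ∉ toDisc '' K := by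
      rintro ⟨x, -, hx⟩
      exact hq (hx ▸ norm_toDisc x)
    refine ContinuousOn.continuousAt ?_ (hV.mem_nhds hq')
    refine continuousOn_snd.congr fun q hq => ?_
    have hq : q.2 ∉ toDisc '' K := hq
    by_cases h1 : ‖q.2.1.2‖ < 1
    · have h2 : ofDisc q.2 ∉ K := fun h3 => hq ⟨_, h3, toDisc_ofDisc _ h1⟩
      simp only [extFun, if_pos h1, h _ _ h2, toDisc_ofDisc _ h1]
    · simp only [extFun, if_neg h1]

lemma continuous_extFun' (f : HAutC n) : Continuous (extFun f.toMap) := by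
  obtain ⟨K, hK, h⟩ := f.compactSupport
  have h1 : Continuous fun q : Unit × D n => extFun f.toMap q.2 :=
    continuous_extFun (Y := Unit) (fun _ x => f.toMap x)
      (f.toMap.continuous.comp continuous_snd) K hK fun _ x hx => h x hx
  have h2 : Continuous fun x : D n => ((), x) := by fun_prop
  have h3 := h1.comp h2
  exact h3

/-- The boundary `B = S^{n-1}` of the disc fibre over `p`, as a subset of `D^*(S^n)`. -/
def fibreSphere (p : S n) : Set (D n) := {x | x.1.1 = p.1 ∧ ‖x.1.2‖ = 1}

lemma extFun_fibreSphere {p : S n} (f : T n → T n) {x : D n} (hx : x ∈ fibreSphere p) :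
    extFun f x = x :=
  if_neg (by rw [hx.2]; exact lt_irrefl _)

/-- The pair `(D^*(S^n), B)`. -/
abbrev discPair (p : S n) : TopPair.{0} := TopPair.ofSubset (X := TopCat.of (D n)) (fibreSphere p)

/-- The self-map of `(D^*(S^n), B)` given by extending `f` by the identity. -/
def extPair (p : S n) (f : HAutC n) : discPair p ⟶ discPair p :=
  TopPair.ofHom (X := discPair p) (Y := discPair p)
    (TopCat.ofHom ⟨extFun f.toMap, continuous_extFun' f⟩) (𝟙 _) (by
      ext x
      exact (extFun_fibreSphere f.toMap x.2).symm)

/-- `H_n(D^*(S^n), B; ℤ)`. -/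
abbrev Hn (p : S n) : ModuleCat.{0} ℤ := (relHomology n).obj (discPair p)

/-- Compactly supported homotopic maps have extensions inducing the same map in homology. -/
lemma relHomology_extPair_eq (p : S n) {f g : HAutC n} (h : CSHomotopic f g) :
    (relHomology n).map (extPair p f) = (relHomology n).map (extPair p g) := by
  obtain ⟨K, hK, ⟨F⟩⟩ := h
  obtain ⟨L, hL, hf⟩ := f.compactSupport
  have hF : Continuous fun q : unitInterval × T n => F (q.1, q.2) := F.continuous
  have hs : ∀ (t : unitInterval), ∀ x ∉ K ∪ L, F (t, x) = x := fun t x hx => by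
    rw [F.eq_fst t (fun hk => hx (Or.inl hk))]
    exact hf x fun hl => hx (Or.inr hl)
  have hc := continuous_extFun (Y := unitInterval) (fun t x => F (t, x)) hF (K ∪ L)
    (hK.union hL) hs
  have hd := hc.comp (continuous_swap (X := D n) (Y := unitInterval))
  let H : cyl (discPair p) ⟶ discPair p :=
    TopPair.ofHom (X := cyl (discPair p)) (Y := discPair p)
      (TopCat.ofHom ⟨fun q => extFun (fun x => F (q.2, x)) q.1, hd⟩)
      (cylProjTop _) (by
        ext x
        exact (extFun_fibreSphere (fun y => F (x.2, y)) x.1.2).symm)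
  have e0 : extPair p f = cylIncl _ 0 ≫ H := by
    ext x
    · rfl
    · change extFun f.toMap x = extFun (fun y => F (0, y)) x
      congr 1
      funext y
      exact (F.map_zero_left y).symm
  have e1 : extPair p g = cylIncl _ 1 ≫ H := by
    ext x
    · rfl
    · change extFun g.toMap x = extFun (fun y => F (1, y)) x
      congr 1
      funext y
      exact (F.map_one_left y).symm
  rw [e0, e1, relHomology_map_eq]

/-- The action of `π_0(hAut_c(T^*S^n))` on `H_n(D^*(S^n), B; ℤ)`. -/
def act (p : S n) (a : PiZeroHAutC n) : Hn p →ₗ[ℤ] Hn p :=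
  Quotient.lift (fun f : HAutC n => ((relHomology n).map (extPair p f)).hom)
    (fun _ _ h => congrArg ModuleCat.Hom.hom (relHomology_extPair_eq p h)) a

/-! ### The classes `[S^n]` and `[D]` -/

/-- The zero section `S^n → D^*(S^n)`. -/
def zeroSection (n : ℕ) : TopCat.of (S n) ⟶ TopCat.of (D n) :=
  TopCat.ofHom ⟨fun u => ⟨(u.1, 0), u.2, by simp, by simp⟩, by fun_prop⟩

/-- The image in `H_n(D^*(S^n), B; ℤ)` of a class `σ ∈ H_n(S^n; ℤ)` under the zero section. -/
def zeroSectionClass (p : S n) (σ : (absHomology n).obj (TopCat.of (S n))) : Hn p :=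
  ((absHomology n).map (zeroSection n) ≫ absToRel n (discPair p)).hom σ

/-- An orientation of `S^n`, given by a fundamental class: a generator of `H_n(S^n; ℤ)`. -/
def IsFundamentalClass (σ : (absHomology n).obj (TopCat.of (S n))) : Prop :=
  Submodule.span ℤ {σ} = ⊤

/-- The fibre `D` of `D^*(S^n)` over `p`. -/
abbrev Fibre (p : S n) := {x : D n // x.1.1 = p.1}

/-- The pair `(D, ∂D)`, where `∂D = B`. -/
abbrev fibrePair (p : S n) : TopPair.{0} :=
  TopPair.ofSubset (X := TopCat.of (Fibre p)) {x | ‖x.1.1.2‖ = 1}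

/-- The inclusion `(D, ∂D) → (D^*(S^n), B)`. -/
def fibreIncl (p : S n) : fibrePair p ⟶ discPair p :=
  TopPair.ofHom (X := fibrePair p) (Y := discPair p)
    (TopCat.ofHom ⟨Subtype.val, continuous_subtype_val⟩)
    (TopCat.ofHom ⟨fun x => ⟨x.1.1, x.1.2, x.2⟩, by fun_prop⟩) rfl

/-- The image in `H_n(D^*(S^n), B; ℤ)` of a class `δ ∈ H_n(D, ∂D; ℤ)`. -/
def fibreClass (p : S n) (δ : (relHomology n).obj (fibrePair p)) : Hn p :=
  ((relHomology n).map (fibreIncl p)).hom δ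

/-- The map `(u, v) ↦ (1 - 2|v|²) u + 2 √(1 - |v|²) v`, i.e. a radial reparametrization of the
exponential map of the round sphere: for `|v| = sin (θ/2)` with `0 ≤ θ ≤ π` it sends `(u, v)` to
`cos θ • u + sin θ • v/|v|`. On the fibre over `p` it has derivative twice the identity of
`T_p S^n` at `v = 0`, is injective on the open disc, and collapses the boundary to `-p`. -/
def wrapFun (x : D n) : E n :=
  (1 - 2 * ‖x.1.2‖ ^ 2) • x.1.1 + (2 * √(1 - ‖x.1.2‖ ^ 2)) • x.1.2

lemma norm_wrapFun (x : D n) : ‖wrapFun x‖ = 1 := by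
  obtain ⟨⟨u, v⟩, hu, huv, hv⟩ := x
  dsimp only at hu huv hv
  have h1 : 0 ≤ 1 - ‖v‖ ^ 2 := by nlinarith [norm_nonneg v]
  have : ‖wrapFun ⟨(u, v), hu, huv, hv⟩‖ ^ 2 = 1 := by
    change ‖(1 - 2 * ‖v‖ ^ 2) • u + (2 * √(1 - ‖v‖ ^ 2)) • v‖ ^ 2 = 1
    rw [norm_add_sq_real, inner_smul_left, inner_smul_right, huv, norm_smul, norm_smul, mul_pow,
      mul_pow, hu, Real.norm_eq_abs, Real.norm_eq_abs, sq_abs, sq_abs, mul_pow, Real.sq_sqrt h1]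
    ring
  nlinarith [norm_nonneg (wrapFun ⟨(u, v), hu, huv, hv⟩)]

/-- The antipode `-p`. -/
def antipode (p : S n) : S n := ⟨-p.1, by rw [norm_neg, p.2]⟩

/-- The pair `(S^n, {-p})`. -/
abbrev spherePair (p : S n) : TopPair.{0} := TopPair.ofSubset (X := TopCat.of (S n)) {antipode p}

lemma wrapFun_boundary (p : S n) (x : Fibre p) (hx : ‖x.1.1.2‖ = 1) :
    (⟨wrapFun x.1, norm_wrapFun x.1⟩ : S n) = antipode p := by
  apply Subtype.ext
  change wrapFun x.1 = -p.1
  unfold wrapFun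
  rw [hx, x.2]
  norm_num

/-- The orientation-preserving degree one map `(D, ∂D) → (S^n, {-p})`, where `D ⊆ T_p S^n` carries
the orientation of the tangent space `T_p S^n`. -/
def wrapPair (p : S n) : fibrePair p ⟶ spherePair p :=
  TopPair.ofHom (X := fibrePair p) (Y := spherePair p)
    (TopCat.ofHom ⟨fun x => ⟨wrapFun x.1, norm_wrapFun x.1⟩, by unfold wrapFun; fun_prop⟩)
    (TopCat.ofHom ⟨fun x => ⟨⟨wrapFun x.1.1, norm_wrapFun x.1.1⟩,
      wrapFun_boundary p x.1 x.2⟩, by unfold wrapFun; fun_prop⟩) rfl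

/-- For even `n` and an orientation `σ` of `S^n`, the orientation of the fibre `D` for which the
intersection number `⟨[D], [S^n]⟩` is `1`, where `T^*S^n` carries its symplectic orientation, which
is that of the complex quadric `{z ∈ ℂ^{n+1} : ∑ z_j² = 1}` (so `⟨[S^n], [S^n]⟩ = 2 (-1)^{n/2}`).

For an oriented basis `e_1, …, e_n` of `T_p S^n`, the complex orientation of
`T_{(p,0)} T^*S^n = T_p S^n ⊗ ℂ` is that of `e_1, i e_1, …, e_n, i e_n`, which differs from
`i e_1, …, i e_n, e_1, …, e_n` by the sign `(-1)^{n(n+1)/2} = (-1)^{n/2}`. So `D` carries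
`(-1)^{n/2}` times the orientation of `T_p S^n`. -/
def IsDualFibreClass (p : S n) (σ : (absHomology n).obj (TopCat.of (S n)))
    (δ : (relHomology n).obj (fibrePair p)) : Prop :=
  ((relHomology n).map (wrapPair p)).hom δ =
    (-1 : ℤ) ^ (n / 2) • (absToRel n (spherePair p)).hom σ

end CotSphere

end

/-! Write ε = (-1)^(n/2), S for the class of the zero section and F for the class of the fibre. Two
maps of pairs serve as coordinates on the homology of (D^*S^n, B). The bundle projection to (S^n, p)
sends S to the orientation class and kills F. The map `wrapFun` to (S^n, -p) sends S to the
orientation class and F to ε times it. Hence S and F are independent; they generate by the long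
exact sequence of the pair.

A compactly supported homotopy equivalence acts by a unit on H_n(T^*S^n) ≅ ℤ, so it sends S to eS
with e = ±1 (`exists_extPair_zeroSectionClass`). The image of F is pinned down by one further class
that cannot move. The extended map is the identity on the unit sphere bundle, so it fixes any class
carried by a relative disc inside that bundle. Such a disc is `blowFun`: an orthonormal pair (p, e)
is reflected in the hyperplanes orthogonal to the unit vectors of the hemisphere centred at p. Its
base point is the antipode of `wrapFun`. For even n the antipodal map has degree -1, so the
projection coordinate of this class is -ε, while its `wrapFun` coordinate is ε; the class is
therefore -εS + 2F (`exists_blowPair_class`). Invariance of this class leaves only F ↦ F when e = 1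
and F ↦ F - εS when e = -1 (`eq_or_eq_neg_of_fixed`).

The topological input is the homology of spheres and the degree of the antipodal map. Both rest on
subdivision into small simplices (`exists_sub_bd_mem_small`) and a Mayer-Vietoris argument for two
contractible open sets: `IsHomologySphere.of_cover` computes the homology, and
`add_push_mem_boundaries_of_swap` gives the degree of a reflection, which exchanges the two sets. -/

noncomputable section

namespace CotSphere

/-! ### Singular chains in terms of elements -/

section SingularHomology

variable {X Y Z : Type} [TopologicalSpace X] [TopologicalSpace Y] [TopologicalSpace Z]

/-- The standard topological `k`-simplex. -/
abbrev Simplex (k : ℕ) : Type := stdSimplex ℝ (Fin (k + 1))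

/-- The group of singular `k`-chains. -/
def Chain (k : ℕ) (X : Type) [TopologicalSpace X] : Type :=
  ((chains.obj (TopCat.of X)).X k : ModuleCat.{0} ℤ)

instance (k : ℕ) : AddCommGroup (Chain k X) :=
  inferInstanceAs (AddCommGroup ((chains.obj (TopCat.of X)).X k : ModuleCat.{0} ℤ))

/-- The boundary operator on singular chains. -/
def bd {k : ℕ} : Chain (k + 1) X →+ Chain k X :=
  ((chains.obj (TopCat.of X)).d (k + 1) k).hom.toAddMonoidHom

/-- Push-forward of singular chains. -/
def push {k : ℕ} (f : C(X, Y)) : Chain k X →+ Chain k Y :=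
  ((chains.map (TopCat.ofHom f)).f k).hom.toAddMonoidHom

/-- The singular chain given by a single singular simplex. -/
def simp1 {k : ℕ} (s : C(Simplex k, X)) : Chain k X :=
  ((TopCat.toSSet.obj (TopCat.of X)).ιChainComplex (R := ModuleCat.of ℤ ℤ) (n := k)
    (((TopCat.of X).toSSetObjEquiv _).symm s)).hom (1 : ℤ)

/-- The inclusion of the `i`-th face of the standard simplex. -/
def face {k : ℕ} (i : Fin (k + 2)) : C(Simplex k, Simplex (k + 1)) :=
  ⟨stdSimplex.map i.succAbove, stdSimplex.continuous_map _⟩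

/-- The chain group is a coproduct of copies of ℤ indexed by singular simplices; its universal
property lives in `ModuleCat`, so additive maps are first made linear. -/
lemma chain_hom_ext {k : ℕ} {M : Type} [AddCommGroup M] {f g : Chain k X →+ M}
    (h : ∀ s : C(Simplex k, X), f (simp1 s) = g (simp1 s)) : f = g := by
  let lin (f : Chain k X →+ M) : (chains.obj (TopCat.of X)).X k ⟶ ModuleCat.of ℤ M :=
    ModuleCat.ofHom
      { toFun := f
        map_add' := f.map_add
        map_smul' := fun n x => by
          exact (congrArg f (int_smul_eq_zsmul (M := (chains.obj (TopCat.of X)).X k) _ n x)).trans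
            (f.map_zsmul n x) }
  have : lin f = lin g := by
    refine SSet.chainComplex_hom_ext fun x => ?_
    ext
    obtain ⟨s, rfl⟩ := ((TopCat.of X).toSSetObjEquiv _).symm.surjective x
    exact h s
  ext x
  exact congrArg (fun m => ModuleCat.Hom.hom m x) this

/-- The homomorphism on chains with prescribed values on singular simplices. -/
def chainLift {k : ℕ} {M : Type} [AddCommGroup M] (φ : C(Simplex k, X) → M) :
    Chain k X →+ M :=
  (Sigma.desc (f := fun _ : (TopCat.toSSet.obj (TopCat.of X)).obj (.op (.mk k)) =>
    ModuleCat.of ℤ ℤ) (P := ModuleCat.of ℤ M) fun x => ModuleCat.ofHom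
      (LinearMap.toSpanSingleton ℤ M (φ ((TopCat.of X).toSSetObjEquiv _ x)))).hom.toAddMonoidHom

@[simp]
lemma chainLift_simp1 {k : ℕ} {M : Type} [AddCommGroup M] (φ : C(Simplex k, X) → M)
    (s : C(Simplex k, X)) : chainLift φ (simp1 s) = φ s := by
  have := Sigma.ι_desc (f := fun _ : (TopCat.toSSet.obj (TopCat.of X)).obj (.op (.mk k)) =>
    ModuleCat.of ℤ ℤ) (P := ModuleCat.of ℤ M) (fun x => ModuleCat.ofHom
      (LinearMap.toSpanSingleton ℤ M (φ ((TopCat.of X).toSSetObjEquiv _ x))))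
      (((TopCat.of X).toSSetObjEquiv _).symm s)
  have := congrArg (fun m => ModuleCat.Hom.hom m (1 : ℤ)) this
  refine this.trans ?_
  simp only [Equiv.apply_symm_apply]
  exact one_smul ℤ _

-- The chains satisfying `p` form a subgroup. Lifting the generators into it and including back
-- gives the identity, so the subgroup is everything.
@[elab_as_elim]
lemma chain_induction {k : ℕ} {p : Chain k X → Prop} (c : Chain k X)
    (simp1 : ∀ s, p (simp1 s)) (zero : p 0) (add : ∀ x y, p x → p y → p (x + y))
    (neg : ∀ x, p x → p (-x)) : p c := by
  let S : AddSubgroup (Chain k X) :=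
    { carrier := {c | p c}
      zero_mem' := zero
      add_mem' := fun hx hy => add _ _ hx hy
      neg_mem' := fun hx => neg _ hx }
  let r : Chain k X →+ S := chainLift fun s => ⟨CotSphere.simp1 s, simp1 s⟩
  have : S.subtype.comp r = AddMonoidHom.id _ := chain_hom_ext fun s => by simp [r]
  have h : (r c : Chain k X) = c := DFunLike.congr_fun this c
  rw [← h]
  exact (r c).2

@[simp]
lemma push_simp1 {k : ℕ} (f : C(X, Y)) (s : C(Simplex k, X)) :
    push f (simp1 s) = simp1 (f.comp s) := by
  have := SSet.ι_chainComplexMap_f _ _ (TopCat.toSSet.map (TopCat.ofHom f)) (ModuleCat.of ℤ ℤ)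
    (((TopCat.of X).toSSetObjEquiv (.op (.mk k))).symm s)
  exact congrArg (fun m => ModuleCat.Hom.hom m (1 : ℤ)) this

lemma bd_simp1 {k : ℕ} (s : C(Simplex (k + 1), X)) :
    bd (simp1 s) = ∑ i : Fin (k + 2), (-1 : ℤ) ^ (i : ℕ) • simp1 (s.comp (face i)) := by
  have := SSet.ιChainComplex_d (TopCat.toSSet.obj (TopCat.of X)) (ModuleCat.of ℤ ℤ)
    (((TopCat.of X).toSSetObjEquiv (.op (.mk (k + 1)))).symm s)
  have := congrArg (fun m => ModuleCat.Hom.hom m (1 : ℤ)) this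
  refine this.trans ?_
  simp
  rfl

lemma bd_bd {k : ℕ} (c : Chain (k + 2) X) : bd (bd c) = 0 := by
  have := (chains.obj (TopCat.of X)).d_comp_d (k + 2) (k + 1) k
  exact congrArg (fun m => ModuleCat.Hom.hom m c) this

lemma bd_push {k : ℕ} (f : C(X, Y)) (c : Chain (k + 1) X) : bd (push f c) = push f (bd c) := by
  have := (chains.map (TopCat.ofHom f)).comm (k + 1) k
  exact congrArg (fun m => ModuleCat.Hom.hom m c) this

lemma push_push {k : ℕ} (g : C(Y, Z)) (f : C(X, Y)) (c : Chain k X) :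
    push g (push f c) = push (g.comp f) c := by
  have : (push g).comp (push f) = push (k := k) (g.comp f) := chain_hom_ext fun s => by
    simp [ContinuousMap.comp_assoc]
  exact DFunLike.congr_fun this c

@[simp]
lemma push_id {k : ℕ} (c : Chain k X) : push (ContinuousMap.id X) c = c := by
  have : push (ContinuousMap.id X) = AddMonoidHom.id (Chain k X) := chain_hom_ext fun s => by
    simp
  exact DFunLike.congr_fun this c

lemma push_injective {k : ℕ} (f : C(X, Y)) (hf : Function.Injective f) :
    Function.Injective (push (k := k) f) := by
  have hm : Mono (TopCat.ofHom f) := (TopCat.mono_iff_injective _).2 hf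
  have : Mono ((chains.map (TopCat.ofHom f)).f k) := inferInstance
  exact (ModuleCat.mono_iff_injective _).1 this

/-! ### Formal simplices and their barycentric subdivision -/

section Formal
variable {α α' : Type}

/-- Formal `k`-chains on ordered tuples of points of `α`. -/
abbrev FChain (k : ℕ) (α : Type) : Type := FreeAbelianGroup (Fin (k + 1) → α)

/-- The boundary of a formal chain. -/
def fbd {k : ℕ} : FChain (k + 1) α →+ FChain k α :=
  FreeAbelianGroup.lift fun w =>
    ∑ i : Fin (k + 2), (-1 : ℤ) ^ (i : ℕ) • FreeAbelianGroup.of (w ∘ i.succAbove)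

/-- The cone with apex `b` on a formal chain. -/
def cone {k : ℕ} (b : α) : FChain k α →+ FChain (k + 1) α :=
  FreeAbelianGroup.map fun w => (Fin.cons b w : Fin (k + 2) → α)

@[simp]
lemma cone_of {k : ℕ} (b : α) (w : Fin (k + 1) → α) :
    cone b (FreeAbelianGroup.of w) = FreeAbelianGroup.of (Fin.cons b w : Fin (k + 2) → α) :=
  FreeAbelianGroup.map_of_apply _

/-- Deleting the apex returns the base; deleting any other vertex gives the cone on a face of the
base, with the sign shifted by one. -/
lemma fbd_cone {k : ℕ} (b : α) (c : FChain (k + 1) α) :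
    fbd (cone b c) = c - cone b (fbd c) := by
  have : fbd.comp (cone b) = AddMonoidHom.id (FChain (k + 1) α) - (cone b).comp fbd := by
    ext w
    have h0 : (Fin.cons b w : Fin (k + 3) → α) ∘ Fin.succ = w := rfl
    simp [fbd, Fin.sum_univ_succ (n := k + 2), -Fin.cons_zero, map_sum, pow_succ, h0,
      sub_eq_add_neg]
    rfl
  exact DFunLike.congr_fun this c

/-- In degree zero the base has no boundary, and deleting its only vertex leaves the apex: this is
the augmentation term. -/
lemma fbd_cone_zero (b : α) (w : Fin 1 → α) :
    fbd (cone b (FreeAbelianGroup.of w)) =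
      FreeAbelianGroup.of w - FreeAbelianGroup.of fun _ => b := by
  have h0 : (Fin.cons b w : Fin 2 → α) ∘ Fin.succ = w := rfl
  have h1 : (Fin.cons b w : Fin 2 → α) ∘ Fin.succAbove 1 = fun _ => b := by
    funext j
    fin_cases j
    rfl
  simp [fbd, Fin.sum_univ_succ (n := 1), h0, h1, sub_eq_add_neg]

/-- Every tuple is the cone from its first entry on its tail, so the cone formula lowers the degree
by one. -/
lemma fbd_fbd {k : ℕ} (c : FChain (k + 2) α) : fbd (fbd c) = 0 := by
  induction k with
  | zero =>
    have : (fbd.comp fbd : FChain 2 α →+ FChain 0 α) = 0 := by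
      ext w
      have h : FreeAbelianGroup.of w = cone (w 0) (FreeAbelianGroup.of (Fin.tail w)) := by
        rw [cone_of, Fin.cons_self_tail]
      have h2 : fbd (FreeAbelianGroup.of (Fin.tail w)) =
          FreeAbelianGroup.of (Fin.tail w ∘ Fin.succAbove 0) -
            FreeAbelianGroup.of (Fin.tail w ∘ Fin.succAbove 1) := by
        simp [fbd, Fin.sum_univ_succ, sub_eq_add_neg]
      simp only [AddMonoidHom.comp_apply, AddMonoidHom.zero_apply]
      rw [h, fbd_cone, map_sub, h2, map_sub, map_sub, fbd_cone_zero, fbd_cone_zero]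
      abel
    exact DFunLike.congr_fun this c
  | succ k ih =>
    have : (fbd.comp fbd : FChain (k + 3) α →+ FChain (k + 1) α) = 0 := by
      ext w
      have h : FreeAbelianGroup.of w = cone (w 0) (FreeAbelianGroup.of (Fin.tail w)) := by
        rw [cone_of, Fin.cons_self_tail]
      simp only [AddMonoidHom.comp_apply, AddMonoidHom.zero_apply]
      rw [h, fbd_cone, map_sub, fbd_cone, ih, map_zero]
      abel
    exact DFunLike.congr_fun this c

lemma map_cone {k : ℕ} (f : α → α') (b : α) (c : FChain k α) :
    FreeAbelianGroup.map (f ∘ ·) (cone b c) = cone (f b) (FreeAbelianGroup.map (f ∘ ·) c) := by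
  induction c using FreeAbelianGroup.induction_on with
  | zero => simp
  | of w => simp [Fin.comp_cons]
  | neg w h => simp [Fin.comp_cons]
  | add x y hx hy => simp [hx, hy]

lemma map_fbd {k : ℕ} (f : α → α') (c : FChain (k + 1) α) :
    FreeAbelianGroup.map (f ∘ ·) (fbd c) = fbd (FreeAbelianGroup.map (f ∘ ·) c) := by
  have : (FreeAbelianGroup.map (f ∘ ·)).comp fbd =
      fbd.comp (FreeAbelianGroup.map (f ∘ ·) : FChain (k + 1) α →+ FChain (k + 1) α') := by
    ext w
    simp [fbd, map_sum, Function.comp_assoc]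
  exact DFunLike.congr_fun this c

/-- The chain homotopy from barycentric subdivision to the identity. -/
def fT (β : ∀ k : ℕ, (Fin (k + 1) → α) → α) : ∀ k : ℕ, FChain k α →+ FChain (k + 1) α
  | 0 => 0
  | k + 1 => FreeAbelianGroup.lift fun w =>
      cone (β _ w) (FreeAbelianGroup.of w - fT β k (fbd (FreeAbelianGroup.of w)))

/-- Barycentric subdivision of formal chains. -/
def fSd (β : ∀ k : ℕ, (Fin (k + 1) → α) → α) : ∀ k : ℕ, FChain k α →+ FChain k α
  | 0 => AddMonoidHom.id _
  -- Subdivision is defined as whatever makes `fT` a chain homotopy to the identity; the geometric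
  -- recursion is recovered in `fSd_succ_of`.
  | k + 1 => AddMonoidHom.id _ - fbd.comp (fT β (k + 1)) - (fT β k).comp fbd

/-- With b the barycentre, ∂Tw = w - T∂w - b(∂w - ∂T∂w). Hence w - ∂Tw - T∂w = b(∂w - ∂T∂w), and the
bracket is Sd ∂w because ∂∂ = 0. -/
lemma fSd_succ_of (β : ∀ k : ℕ, (Fin (k + 1) → α) → α) (k : ℕ) (w : Fin (k + 2) → α) :
    fSd β (k + 1) (FreeAbelianGroup.of w) =
      cone (β _ w) (fSd β k (fbd (FreeAbelianGroup.of w))) := by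
  have h : fT β (k + 1) (FreeAbelianGroup.of w) =
      cone (β _ w) (FreeAbelianGroup.of w - fT β k (fbd (FreeAbelianGroup.of w))) :=
    FreeAbelianGroup.lift_apply_of _ _
  simp only [fSd, AddMonoidHom.sub_apply, AddMonoidHom.id_apply, AddMonoidHom.comp_apply, h,
    fbd_cone]
  cases k with
  | zero => simp [fT]
  | succ k =>
    simp only [map_sub, fbd_fbd, map_zero, AddMonoidHom.sub_apply, AddMonoidHom.comp_apply,
      AddMonoidHom.id_apply]
    abel

/-- Applied to affine maps, which preserve barycentres, this transports constructions on the
standard simplex to every affine simplex. -/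
lemma map_fT (β : ∀ k : ℕ, (Fin (k + 1) → α) → α) (β' : ∀ k : ℕ, (Fin (k + 1) → α') → α')
    (f : α → α') (hf : ∀ k w, f (β k w) = β' k (f ∘ w)) (k : ℕ) (c : FChain k α) :
    FreeAbelianGroup.map (f ∘ ·) (fT β k c) = fT β' k (FreeAbelianGroup.map (f ∘ ·) c) := by
  induction k with
  | zero => simp [fT]
  | succ k ih =>
    have : (FreeAbelianGroup.map (f ∘ ·)).comp (fT β (k + 1)) = (fT β' (k + 1)).comp
        (FreeAbelianGroup.map (f ∘ ·) : FChain (k + 1) α →+ FChain (k + 1) α') := by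
      ext w
      simp [fT, map_cone, ih, map_fbd, hf, Fin.comp_cons]
    exact DFunLike.congr_fun this c

end Formal

/-! ### Affine simplices -/

/-- The affine map between standard simplices with prescribed values at the vertices. -/
def affMap {k m : ℕ} (w : Fin (k + 1) → Simplex m) : C(Simplex k, Simplex m) where
  toFun t := ⟨∑ i, t.1 i • (w i).1, (convex_stdSimplex ℝ _).sum_mem (fun i _ => t.2.1 i) t.2.2
    fun i _ => (w i).2⟩
  continuous_toFun := by
    refine Continuous.subtype_mk (continuous_finsetSum _ fun i _ => ?_) _
    exact ((continuous_apply i).comp continuous_subtype_val).smul continuous_const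

lemma affMap_comp {k l m : ℕ} (v : Fin (l + 1) → Simplex m) (w : Fin (k + 1) → Simplex l) :
    (affMap v).comp (affMap w) = affMap (affMap v ∘ w) := by
  ext t j
  change (∑ i, (∑ a, t.1 a • (w a).1) i • (v i).1) j = (∑ a, t.1 a • ∑ i, (w a).1 i • (v i).1) j
  simp only [Finset.sum_apply, Pi.smul_apply, smul_eq_mul, Finset.sum_mul, Finset.mul_sum]
  rw [Finset.sum_comm]
  simp only [mul_assoc]

lemma affMap_face {k m : ℕ} (w : Fin (k + 2) → Simplex m) (i : Fin (k + 2)) :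
    (affMap w).comp (face i) = affMap (w ∘ i.succAbove) := by
  ext t j
  change (∑ a, (stdSimplex.map i.succAbove t).1 a • (w a).1) j =
    (∑ a, t.1 a • (w (i.succAbove a)).1) j
  have h (a : Fin (k + 2)) : (stdSimplex.map i.succAbove t).1 a =
      ∑ b with i.succAbove b = a, t.1 b := FunOnFinite.linearMap_apply_apply ..
  simp only [h, Finset.sum_smul]
  rw [← Finset.sum_fiberwise Finset.univ i.succAbove]
  refine congrFun (Finset.sum_congr rfl fun a _ => Finset.sum_congr rfl fun b hb => ?_) j
  rw [(Finset.mem_filter.1 hb).2]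

lemma affMap_vertex {k m : ℕ} (w : Fin (k + 1) → Simplex m) (i : Fin (k + 1)) :
    affMap w (stdSimplex.vertex i) = w i := by
  apply Subtype.ext
  change ∑ a, (Pi.single i 1 : Fin (k + 1) → ℝ) a • (w a).1 = (w i).1
  simp [Pi.single_apply]

lemma affMap_vertex_self (k : ℕ) :
    affMap (stdSimplex.vertex : Fin (k + 1) → Simplex k) = ContinuousMap.id _ := by
  ext t j
  change (∑ a, t.1 a • (Pi.single a 1 : Fin (k + 1) → ℝ)) j = t.1 j
  simp [Pi.single_apply]

/-- The barycenter of an affine simplex. -/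
def bary {m : ℕ} (k : ℕ) (w : Fin (k + 1) → Simplex m) : Simplex m :=
  affMap w stdSimplex.barycenter

lemma affMap_bary {k l m : ℕ} (v : Fin (l + 1) → Simplex m) (w : Fin (k + 1) → Simplex l) :
    affMap v (bary k w) = bary k (affMap v ∘ w) := by
  rw [bary, bary, ← affMap_comp]
  rfl

/-- The singular chain of an affine chain. -/
def affC {k m : ℕ} : FChain k (Simplex m) →+ Chain k (Simplex m) :=
  FreeAbelianGroup.lift fun w => simp1 (affMap w)

@[simp]
lemma affC_of {k m : ℕ} (w : Fin (k + 1) → Simplex m) :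
    affC (FreeAbelianGroup.of w) = simp1 (affMap w) :=
  FreeAbelianGroup.lift_apply_of _ _

lemma bd_affC {k m : ℕ} (c : FChain (k + 1) (Simplex m)) : bd (affC c) = affC (fbd c) := by
  have : bd.comp (affC (k := k + 1) (m := m)) = affC.comp fbd := by
    ext w
    simp [fbd, bd_simp1, affMap_face]
  exact DFunLike.congr_fun this c

lemma push_affMap_affC {k l m : ℕ} (v : Fin (l + 1) → Simplex m) (c : FChain k (Simplex l)) :
    push (affMap v) (affC c) = affC (FreeAbelianGroup.map (affMap v ∘ ·) c) := by
  have : (push (affMap v)).comp (affC (k := k)) =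
      affC.comp (FreeAbelianGroup.map (affMap v ∘ ·)) := by
    ext w
    simp [affMap_comp]
  exact DFunLike.congr_fun this c

/-! ### Barycentric subdivision of singular chains -/

/-- The natural homotopy from barycentric subdivision to the identity. -/
def sT (k : ℕ) : Chain k X →+ Chain (k + 1) X :=
  chainLift fun s => push s (affC (fT bary k (FreeAbelianGroup.of stdSimplex.vertex)))

/-- Barycentric subdivision of singular chains. -/
def sSd : ∀ k : ℕ, Chain k X →+ Chain k X
  | 0 => AddMonoidHom.id _
  | k + 1 => AddMonoidHom.id _ - bd.comp (sT (k + 1)) - (sT k).comp bd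

lemma sT_push {k : ℕ} (f : C(X, Y)) (c : Chain k X) : sT k (push f c) = push f (sT k c) := by
  have : (sT k).comp (push f) = (push f).comp (sT k) :=
    chain_hom_ext fun s => by simp [sT, push_push]
  exact DFunLike.congr_fun this c

/-- Since affine maps preserve barycentres, the singular operator restricts to the formal one;
iterated subdivisions can then be computed on formal chains. -/
lemma sT_affC {k m : ℕ} (c : FChain k (Simplex m)) : sT k (affC c) = affC (fT bary k c) := by
  have : (sT k).comp (affC (m := m)) = affC.comp (fT bary k) := by
    ext w
    have h : affMap w ∘ stdSimplex.vertex = w := funext fun i => affMap_vertex w i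
    simp [sT, push_affMap_affC, map_fT bary bary (affMap w) fun k v => affMap_bary w v, h]
  exact DFunLike.congr_fun this c

lemma sSd_push {k : ℕ} (f : C(X, Y)) (c : Chain k X) : sSd k (push f c) = push f (sSd k c) := by
  cases k with
  | zero => rfl
  | succ k => simp [sSd, sT_push, bd_push]

lemma sSd_affC {k m : ℕ} (c : FChain k (Simplex m)) : sSd k (affC c) = affC (fSd bary k c) := by
  cases k with
  | zero => rfl
  | succ k => simp [sSd, fSd, sT_affC, bd_affC]

lemma bd_sSd {k : ℕ} (c : Chain (k + 1) X) : bd (sSd (k + 1) c) = sSd k (bd c) := by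
  cases k with
  | zero =>
    have h : (sT 0 : Chain 0 X →+ _) = 0 := chain_hom_ext fun s => by simp [sT, fT]
    simp [sSd, bd_bd, h]
  | succ k => simp [sSd, bd_bd]

lemma sub_bd_sT {k : ℕ} (c : Chain (k + 1) X) :
    c - bd (sT (k + 1) c) = sSd (k + 1) c + sT k (bd c) := by
  simp [sSd]

lemma iterate_sSd_simp1 {k : ℕ} (s : C(Simplex k, X)) (m : ℕ) :
    (sSd k)^[m] (simp1 s) =
      push s (affC ((fSd bary k)^[m] (FreeAbelianGroup.of stdSimplex.vertex))) := by
  induction m with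
  | zero => simp [affMap_vertex_self]
  | succ m ih => rw [Function.iterate_succ_apply', Function.iterate_succ_apply', ih, sSd_push,
      sSd_affC]

/-! ### Small simplices -/

/-- The formal chains supported on tuples with a given property. -/
abbrev supported {k : ℕ} {α : Type} (P : (Fin (k + 1) → α) → Prop) : AddSubgroup (FChain k α) :=
  AddSubgroup.closure (FreeAbelianGroup.of '' {w | P w})

lemma supported_mono {k : ℕ} {α : Type} {P Q : (Fin (k + 1) → α) → Prop} (h : ∀ w, P w → Q w)
    {c : FChain k α} (hc : c ∈ supported P) : c ∈ supported Q :=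
  AddSubgroup.closure_mono (Set.image_mono h) hc

lemma map_mem_of_supported {k : ℕ} {α M : Type} [AddCommGroup M] {P : (Fin (k + 1) → α) → Prop}
    {S : AddSubgroup M} (f : FChain k α →+ M) (h : ∀ w, P w → f (FreeAbelianGroup.of w) ∈ S)
    {c : FChain k α} (hc : c ∈ supported P) : f c ∈ S := by
  have : supported P ≤ S.comap f := by
    rw [AddSubgroup.closure_le]
    rintro _ ⟨w, hw, rfl⟩
    exact h w hw
  exact this hc

/-- The points of `v` lie in the convex hull of the points of `w`, and are at distance at
most `d` from each other. -/
def Fine {k l m : ℕ} (w : Fin (l + 1) → Simplex m) (d : ℝ) (v : Fin (k + 1) → Simplex m) : Prop :=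
  (∀ S : Set (Fin (m + 1) → ℝ), Convex ℝ S → (∀ i, (w i).1 ∈ S) → ∀ i, (v i).1 ∈ S) ∧
    ∀ i j, dist (v i) (v j) ≤ d

lemma bary_mem {k m : ℕ} (w : Fin (k + 1) → Simplex m) {S : Set (Fin (m + 1) → ℝ)}
    (hS : Convex ℝ S) (h : ∀ i, (w i).1 ∈ S) (t : Simplex k) : (affMap w t).1 ∈ S :=
  hS.sum_mem (fun i _ => t.2.1 i) t.2.2 fun i _ => h i

/-- The difference `w i - bary k w` is the average of the `k + 1` vectors `w i - w j`, one of which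
is zero; this gives the factor `k / (k + 1)`. -/
lemma dist_bary {k m : ℕ} {w : Fin (k + 1) → Simplex m} {d : ℝ}
    (hw : ∀ i j, dist (w i) (w j) ≤ d) (i : Fin (k + 1)) :
    dist (w i) (bary k w) ≤ k / (k + 1) * d := by
  have h1 : (w i).1 - (bary k w).1 = ((k : ℝ) + 1)⁻¹ • ∑ j, ((w i).1 - (w j).1) := by
    have : (bary k w).1 = ((k : ℝ) + 1)⁻¹ • ∑ j, (w j).1 := by
      change ∑ j, (stdSimplex.barycenter : stdSimplex ℝ (Fin (k + 1))).1 j • (w j).1 = _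
      simp [Finset.smul_sum]
    rw [this, Finset.sum_sub_distrib, smul_sub]
    congr 1
    simp only [Finset.sum_const, Finset.card_univ, Fintype.card_fin]
    rw [← Nat.cast_smul_eq_nsmul ℝ, smul_smul]
    push_cast
    rw [inv_mul_cancel₀ (by positivity), one_smul]
  have h2 : ‖∑ j, ((w i).1 - (w j).1)‖ ≤ k * d := by
    rw [Fin.sum_univ_succAbove _ i, sub_self, zero_add]
    refine (norm_sum_le _ _).trans ?_
    refine (Finset.sum_le_sum fun j _ => ?_).trans (b := ∑ _j : Fin k, d) (by simp)
    rw [← dist_eq_norm]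
    exact hw _ _
  rw [Subtype.dist_eq, dist_eq_norm, h1, norm_smul, norm_inv, Real.norm_of_nonneg (by positivity),
    div_eq_inv_mul, mul_assoc]
  gcongr

lemma fSd_mem {k m : ℕ} (w : Fin (k + 1) → Simplex m) {d : ℝ}
    (hw : ∀ i j, dist (w i) (w j) ≤ d) :
    fSd bary k (FreeAbelianGroup.of w) ∈ supported (Fine (k := k) w (k / (k + 1) * d)) := by
  have hd : 0 ≤ d := dist_nonneg.trans (hw 0 0)
  induction k with
  | zero =>
    refine AddSubgroup.subset_closure ⟨w, ⟨fun S _ h => h, fun i j => ?_⟩, rfl⟩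
    rw [Subsingleton.elim (α := Fin 1) i j]
    simp
  | succ k ih =>
    rw [fSd_succ_of]
    refine map_mem_of_supported (P := Fine w (k / (k + 1) * d)) (cone _) (fun v hv => ?_) ?_
    · rw [cone_of]
      refine AddSubgroup.subset_closure ⟨_, ⟨fun S hS h => ?_, ?_⟩, rfl⟩
      · exact Fin.cases (bary_mem w hS h _) fun i => hv.1 S hS h i
      · have hb (i : Fin (k + 1)) : dist (v i) (bary (k + 1) w) ≤ (k + 1 : ℕ) / ((k + 1 : ℕ) + 1) * d := by
          -- A closed ball around the barycentre contains all vertices of `w`; being convex, it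
          -- contains the vertices of the finer simplex too.
          have := hv.1 (Metric.closedBall (bary (k + 1) w).1 ((k + 1 : ℕ) / ((k + 1 : ℕ) + 1) * d))
            (convex_closedBall _ _) (fun i => dist_bary hw i) i
          exact this
        have hk : (k : ℝ) / (k + 1) * d ≤ (k + 1 : ℕ) / ((k + 1 : ℕ) + 1) * d := by
          refine mul_le_mul_of_nonneg_right ?_ hd
          rw [div_le_div_iff₀ (by positivity) (by positivity)]
          push_cast
          nlinarith
        refine Fin.cases (Fin.cases ?_ fun j => ?_) fun i => Fin.cases ?_ fun j => ?_
        · simp only [Fin.cons_zero, dist_self]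
          positivity
        · simp only [Fin.cons_zero, Fin.cons_succ]
          rw [dist_comm]
          exact hb j
        · exact hb i
        · exact (hv.2 i j).trans hk
    · rw [show fbd (FreeAbelianGroup.of w) = ∑ i : Fin (k + 2), (-1 : ℤ) ^ (i : ℕ) •
        FreeAbelianGroup.of (w ∘ i.succAbove) from FreeAbelianGroup.lift_apply_of _ _, map_sum]
      refine sum_mem fun i _ => ?_
      rw [map_zsmul]
      refine zsmul_mem ?_ _
      refine supported_mono (fun v hv => ⟨fun S hS h => ?_, hv.2⟩)
        (ih (w ∘ i.succAbove) fun a b => hw _ _)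
      exact hv.1 S hS fun a => h _

lemma iterate_fSd_mem {k m : ℕ} (w : Fin (k + 1) → Simplex m) {d : ℝ}
    (hw : ∀ i j, dist (w i) (w j) ≤ d) (N : ℕ) :
    (fSd bary k)^[N] (FreeAbelianGroup.of w) ∈
      supported (Fine (k := k) w ((k / (k + 1)) ^ N * d)) := by
  induction N with
  | zero => exact AddSubgroup.subset_closure ⟨w, ⟨fun S _ h => h, by simpa using hw⟩, rfl⟩
  | succ N ih =>
    rw [Function.iterate_succ_apply']
    refine map_mem_of_supported (P := _) _ (fun v hv => ?_) ih
    refine supported_mono (fun u hu => ⟨fun S hS h => ?_, ?_⟩)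
      (fSd_mem v hv.2)
    · exact hu.1 S hS (hv.1 S hS h)
    · rw [pow_succ', mul_assoc]
      exact hu.2

/-- The inclusion of a subspace. -/
abbrev incl (A : Set X) : C(A, X) := ⟨Subtype.val, continuous_subtype_val⟩

/-- The inclusion of a subspace into a larger one. -/
abbrev inclOfLE {A B : Set X} (h : A ⊆ B) : C(A, B) := ⟨Set.inclusion h, continuous_inclusion h⟩

/-- The chains that are sums of a chain in `A` and a chain in `B`. -/
def small (k : ℕ) (A B : Set X) : AddSubgroup (Chain k X) :=
  (push (k := k) (incl A)).range ⊔
    (push (k := k) (incl B)).range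

lemma simp1_mem_range {k : ℕ} (s : C(Simplex k, X)) {A : Set X} (h : ∀ t, s t ∈ A) :
    simp1 s ∈ (push (k := k) (incl A)).range :=
  ⟨simp1 ⟨fun t => ⟨s t, h t⟩, by fun_prop⟩, by rw [push_simp1]; rfl⟩

/-- An operator natural in the space sends chains in `A` to chains in `A`, and likewise for `B`. It
is used for `sSd` and `sT`. -/
lemma natural_mem_small {k l : ℕ} {A B : Set X} (F : ∀ (Y : Type) [TopologicalSpace Y],
      Chain k Y →+ Chain l Y)
    (hF : ∀ (Y Z : Type) [TopologicalSpace Y] [TopologicalSpace Z] (f : C(Y, Z)) (c : Chain k Y),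
      F Z (push f c) = push f (F Y c)) {c : Chain k X} (hc : c ∈ small k A B) :
    F X c ∈ small l A B := by
  obtain ⟨_, ⟨a, rfl⟩, _, ⟨b, rfl⟩, rfl⟩ := AddSubgroup.mem_sup.1 hc
  rw [map_add, hF, hF]
  exact add_mem (AddSubgroup.mem_sup_left ⟨_, rfl⟩) (AddSubgroup.mem_sup_right ⟨_, rfl⟩)

lemma sSd_mem_small {k : ℕ} {A B : Set X} {c : Chain k X} (hc : c ∈ small k A B) :
    sSd k c ∈ small k A B :=
  natural_mem_small (fun _ _ => sSd k) (fun _ _ _ _ => sSd_push) hc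

/-- Pull the cover back to the simplex and take a Lebesgue number. The diameters after `N`
subdivisions are at most `(k / (k + 1)) ^ N` times the original one, so eventually each piece lies
in a ball inside one preimage. -/
lemma exists_iterate_sSd_simp1_mem_small {k : ℕ} {A B : Set X} (hA : IsOpen A) (hB : IsOpen B)
    (hAB : A ∪ B = Set.univ) (s : C(Simplex k, X)) : ∃ N, (sSd k)^[N] (simp1 s) ∈ small k A B := by
  obtain ⟨δ, hδ, h⟩ := lebesgue_number_lemma_of_metric (s := Set.univ)
    (c := fun i : Bool => s ⁻¹' (if i then A else B)) isCompact_univ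
    (fun i => by
      cases i
      · exact hB.preimage s.continuous
      · exact hA.preimage s.continuous)
    (fun t _ => by
      rcases (hAB ▸ Set.mem_univ (s t) : s t ∈ A ∪ B) with h | h
      · exact Set.mem_iUnion.2 ⟨true, h⟩
      · exact Set.mem_iUnion.2 ⟨false, h⟩)
  let d := Metric.diam (Set.univ : Set (Simplex k))
  have hd : ∀ x y : Simplex k, dist x y ≤ d := fun x y =>
    Metric.dist_le_diam_of_mem isCompact_univ.isBounded (Set.mem_univ _) (Set.mem_univ _)
  have hlt : (k : ℝ) / (k + 1) < 1 := by
    rw [div_lt_one (by positivity)]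
    linarith
  have ht : Filter.Tendsto (fun N : ℕ => ((k : ℝ) / (k + 1)) ^ N * d) Filter.atTop (nhds 0) := by
    simpa using (tendsto_pow_atTop_nhds_zero_of_lt_one (by positivity) hlt).mul_const d
  obtain ⟨N, hN⟩ := (ht.eventually (gt_mem_nhds hδ)).exists
  refine ⟨N, ?_⟩
  rw [iterate_sSd_simp1]
  refine map_mem_of_supported ((push s).comp affC) (fun v hv => ?_)
    (iterate_fSd_mem _ (fun i j => hd _ _) N)
  obtain ⟨i, hi⟩ := h (v 0) (Set.mem_univ _)
  have hv' : ∀ t, s (affMap v t) ∈ (if i then A else B) := fun t => by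
    refine hi ?_
    have := bary_mem v (convex_ball (v 0).1 δ) (fun j => (hv.2 j 0).trans_lt hN) t
    exact this
  rw [AddMonoidHom.comp_apply, affC_of, push_simp1]
  cases i
  · exact AddSubgroup.mem_sup_right (simp1_mem_range _ hv')
  · exact AddSubgroup.mem_sup_left (simp1_mem_range _ hv')

lemma exists_iterate_sSd_mem_small {k : ℕ} {A B : Set X} (hA : IsOpen A) (hB : IsOpen B)
    (hAB : A ∪ B = Set.univ) (c : Chain k X) : ∃ N, (sSd k)^[N] c ∈ small k A B := by
  -- Further subdivision keeps a chain small, so two summands can be given a common exponent.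
  have mono (x : Chain k X) (N M : ℕ) (h : (sSd k)^[N] x ∈ small k A B) :
      (sSd k)^[M + N] x ∈ small k A B := by
    induction M with
    | zero => simpa using h
    | succ M ih =>
      rw [Nat.succ_add, Function.iterate_succ_apply']
      exact sSd_mem_small ih
  induction c using chain_induction with
  | simp1 s => exact exists_iterate_sSd_simp1_mem_small hA hB hAB s
  | zero => exact ⟨0, zero_mem _⟩
  | add x y hx hy =>
    obtain ⟨N, hN⟩ := hx
    obtain ⟨M, hM⟩ := hy
    refine ⟨M + N, ?_⟩
    rw [iterate_map_add]
    exact add_mem (mono _ _ _ hN) (add_comm M N ▸ mono _ _ _ hM)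
  | neg x hx =>
    obtain ⟨N, hN⟩ := hx
    refine ⟨N, ?_⟩
    rw [iterate_map_neg]
    exact neg_mem hN

/-- A chain whose boundary is small with respect to an open cover is homologous to a small
chain. -/
theorem exists_sub_bd_mem_small {k : ℕ} {A B : Set X} (hA : IsOpen A) (hB : IsOpen B)
    (hAB : A ∪ B = Set.univ) (c : Chain (k + 1) X) (hc : bd c ∈ small k A B) :
    ∃ e, c - bd e ∈ small (k + 1) A B := by
  obtain ⟨N, hN⟩ := exists_iterate_sSd_mem_small hA hB hAB c
  -- Since c - ∂Tc = Sd c + T∂c and T∂c is small by naturality, `c` may be replaced by its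
  -- subdivision, at the cost of one power of `sSd`.
  induction N generalizing c with
  | zero => exact ⟨0, by simpa using hN⟩
  | succ N ih =>
    obtain ⟨e, he⟩ := ih (sSd _ c) (by rw [bd_sSd]; exact sSd_mem_small hc)
      (by rwa [Function.iterate_succ_apply] at hN)
    refine ⟨sT _ c + e, ?_⟩
    have : c - bd (sT _ c + e) = sSd _ c - bd e + sT _ (bd c) := by
      rw [map_add, ← sub_sub, sub_bd_sT]
      abel
    rw [this]
    exact add_mem he (natural_mem_small (fun _ _ => sT k) (fun _ _ _ _ => sT_push) hc)

/-! ### Cycles, boundaries and homology classes -/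

/-- The cycle condition on singular chains. -/
def IsCycle : ∀ {k : ℕ}, Chain k X → Prop
  | 0, _ => True
  | _ + 1, z => bd z = 0

/-- The singular chains that are boundaries. -/
def boundaries (k : ℕ) (X : Type) [TopologicalSpace X] : AddSubgroup (Chain k X) :=
  (bd (k := k) (X := X)).range

lemma IsCycle.map {k : ℕ} (f : C(X, Y)) {z : Chain k X} (hz : IsCycle z) :
    IsCycle (push f z) := by
  cases k with
  | zero => trivial
  | succ k =>
    have hz : bd z = 0 := hz
    change bd _ = 0
    rw [bd_push, hz, map_zero]

lemma IsCycle.of_map {k : ℕ} (f : C(X, Y)) (hf : Function.Injective f) {z : Chain k X}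
    (hz : IsCycle (push f z)) : IsCycle z := by
  cases k with
  | zero => trivial
  | succ k =>
    have hz : bd (push f z) = 0 := hz
    rw [bd_push] at hz
    exact push_injective f hf (hz.trans (map_zero _).symm)

lemma isCycle_bd {k : ℕ} (c : Chain (k + 1) X) : IsCycle (bd c) := by
  cases k with
  | zero => trivial
  | succ k => exact bd_bd c

lemma IsCycle.zsmul {k : ℕ} {z : Chain k X} (hz : IsCycle z) (a : ℤ) : IsCycle (a • z) := by
  cases k with
  | zero => trivial
  | succ k =>
    have hz : bd z = 0 := hz
    change bd _ = 0
    rw [map_zsmul, hz, smul_zero]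

lemma push_mem_boundaries {k : ℕ} (f : C(X, Y)) {z : Chain k X} (hz : z ∈ boundaries k X) :
    push f z ∈ boundaries k Y := by
  obtain ⟨c, rfl⟩ := hz
  exact ⟨push f c, bd_push f c⟩

section Represents

variable {K L : ChainComplex (ModuleCat.{0} ℤ) ℕ} {k : ℕ}

/-- The homology class `x` is represented by the chain `z`. -/
def Represents (z : K.X k) (x : K.homology k) : Prop :=
  ∃ y : K.cycles k, (K.iCycles k).hom y = z ∧ (K.homologyπ k).hom y = x

lemma exists_represents (x : K.homology k) : ∃ z : K.X k, Represents z x := by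
  have : Function.Surjective (K.homologyπ k).hom := (ModuleCat.epi_iff_surjective _).1 inferInstance
  obtain ⟨y, rfl⟩ := this x
  exact ⟨_, y, rfl, rfl⟩

lemma Represents.sub {z w : K.X k} {x y : K.homology k} (h : Represents z x)
    (h' : Represents w y) : Represents (z - w) (x - y) := by
  obtain ⟨a, rfl, rfl⟩ := h
  obtain ⟨b, rfl, rfl⟩ := h'
  exact ⟨a - b, map_sub _ _ _, map_sub _ _ _⟩

lemma Represents.zsmul {z : K.X k} {x : K.homology k} (h : Represents z x) (a : ℤ) :
    Represents (a • z) (a • x) := by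
  obtain ⟨y, rfl, rfl⟩ := h
  exact ⟨a • y, map_zsmul _ _ _, map_zsmul _ _ _⟩

lemma Represents.map (f : K ⟶ L) {z : K.X k} {x : K.homology k} (h : Represents z x) :
    Represents ((f.f k).hom z) ((HomologicalComplex.homologyMap f k).hom x) := by
  obtain ⟨y, rfl, rfl⟩ := h
  refine ⟨(HomologicalComplex.cyclesMap f k).hom y, ?_, ?_⟩
  · exact congrArg (fun m => ModuleCat.Hom.hom m y) (HomologicalComplex.cyclesMap_i f k)
  · exact congrArg (fun m => ModuleCat.Hom.hom m y)
      (HomologicalComplex.homologyπ_naturality f k).symm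

lemma represents_zero_iff {z : K.X k} :
    Represents z (0 : K.homology k) ↔ ∃ e : K.X (k + 1), (K.d (k + 1) k).hom e = z := by
  constructor
  · rintro ⟨y, rfl, hy⟩
    have hex : (ShortComplex.mk _ _ (K.toCycles_comp_homologyπ (k + 1) k)).Exact :=
      ShortComplex.exact_of_g_is_cokernel _ (K.homologyIsCokernel (k + 1) k (by simp))
    obtain ⟨e, he⟩ := (ShortComplex.moduleCat_exact_iff _).1 hex y hy
    refine ⟨e, ?_⟩
    rw [← K.toCycles_i (k + 1) k]
    exact congrArg (K.iCycles k).hom he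
  · rintro ⟨e, rfl⟩
    refine ⟨(K.toCycles (k + 1) k).hom e, ?_, ?_⟩
    · exact congrArg (fun m => ModuleCat.Hom.hom m e) (K.toCycles_i (k + 1) k)
    · exact congrArg (fun m => ModuleCat.Hom.hom m e) (K.toCycles_comp_homologyπ (k + 1) k)

end Represents

lemma Represents.isCycle {k : ℕ} {z : Chain k X} {x : (absHomology k).obj (TopCat.of X)}
    (h : Represents (K := chains.obj (TopCat.of X)) z x) : IsCycle z := by
  cases k with
  | zero => trivial
  | succ k =>
    obtain ⟨y, rfl, -⟩ := h
    exact congrArg (fun m => ModuleCat.Hom.hom m y) ((chains.obj (TopCat.of X)).iCycles_d (k + 1) k)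

lemma IsCycle.exists_represents {k : ℕ} {z : Chain k X} (h : IsCycle z) :
    ∃ x : (absHomology k).obj (TopCat.of X), Represents (K := chains.obj (TopCat.of X)) z x := by
  let K := chains.obj (TopCat.of X)
  have hz : (K.d k ((ComplexShape.down ℕ).next k)).hom z = 0 := by
    cases k with
    | zero => rw [K.shape _ _ (by simp)]; rfl
    | succ k => rw [ChainComplex.next_nat_succ]; exact h
  let S := ShortComplex.mk (K.iCycles k) (K.d k ((ComplexShape.down ℕ).next k)) (K.iCycles_d _ _)
  have hex : S.Exact := ShortComplex.exact_of_f_is_kernel _ (K.cyclesIsKernel k _ rfl)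
  obtain ⟨y, hy⟩ := (ShortComplex.moduleCat_exact_iff _).1 hex z hz
  exact ⟨_, y, hy, rfl⟩

lemma represents_zero_iff_mem_boundaries {k : ℕ} {z : Chain k X} :
    Represents (K := chains.obj (TopCat.of X)) z 0 ↔ z ∈ boundaries k X :=
  represents_zero_iff

lemma push_sub_push_mem_boundaries {k : ℕ} {f g : C(X, Y)} (h : f.Homotopic g) {z : Chain k X}
    (hz : IsCycle z) : push f z - push g z ∈ boundaries k Y := by
  obtain ⟨H⟩ := h
  let f' : TopCat.of X ⟶ TopCat.of Y := TopCat.ofHom f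
  let g' : TopCat.of X ⟶ TopCat.of Y := TopCat.ofHom g
  have H' : TopCat.Homotopy f' g' := H
  obtain ⟨x, hx⟩ := hz.exists_represents
  have h1 := hx.map (chains.map f')
  rw [H'.congr_homologyMap_singularChainComplexFunctor (ModuleCat.of ℤ ℤ) k] at h1
  have h2 := h1.sub (hx.map (chains.map g'))
  rw [sub_self] at h2
  exact represents_zero_iff_mem_boundaries.1 h2

/-- The map to a point. -/
def toPt (X : Type) [TopologicalSpace X] : C(X, Unit) := ContinuousMap.const X ()

/-- The cycles that are trivial in the homology of a point. -/
structure IsReducedCycle {k : ℕ} (z : Chain k X) : Prop where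
  isCycle : IsCycle z
  toPt_mem : push (toPt X) z ∈ boundaries k Unit

/-- A point has no homology in positive degree, so being reduced is a condition in degree zero only.
-/
lemma IsCycle.isReducedCycle {k : ℕ} {z : Chain (k + 1) X} (hz : IsCycle z) :
    IsReducedCycle z := by
  refine ⟨hz, ?_⟩
  obtain ⟨x, hx⟩ := (hz.map (toPt X)).exists_represents
  have h0 := AlgebraicTopology.isZero_singularHomologyFunctor_of_totallyDisconnectedSpace
    (ModuleCat.{0} ℤ) (k + 1) (ModuleCat.of ℤ ℤ) (TopCat.of Unit) (Nat.succ_ne_zero k)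
  have : x = 0 := (ModuleCat.subsingleton_of_isZero h0).elim _ _
  rw [this] at hx
  exact represents_zero_iff_mem_boundaries.1 hx

lemma IsReducedCycle.map {k : ℕ} (f : C(X, Y)) {z : Chain k X} (hz : IsReducedCycle z) :
    IsReducedCycle (push f z) :=
  ⟨hz.1.map f, by rw [push_push]; exact hz.2⟩

/-- The identity is homotopic to a constant map, so `z` is homologous to its image through a point,
and that image bounds because `z` is reduced. -/
lemma IsReducedCycle.mem_boundaries [ContractibleSpace X] {k : ℕ} {z : Chain k X}
    (hz : IsReducedCycle z) : z ∈ boundaries k X := by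
  obtain ⟨x, hx⟩ := id_nullhomotopic X
  have h := push_sub_push_mem_boundaries hx hz.1
  have e : push (ContinuousMap.const X x) z =
      push (ContinuousMap.const Unit x) (push (toPt X) z) := by
    rw [push_push]
    rfl
  rw [push_id, e] at h
  simpa using add_mem h (push_mem_boundaries (ContinuousMap.const Unit x) hz.2)

/-- The reduced homology of `X` in degree `k` is infinite cyclic. -/
def IsHomologySphere (k : ℕ) (X : Type) [TopologicalSpace X] : Prop :=
  ∃ z : Chain k X, IsReducedCycle z ∧
    (∀ y : Chain k X, IsReducedCycle y → ∃ a : ℤ, y - a • z ∈ boundaries k X) ∧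
    ∀ a : ℤ, a • z ∈ boundaries k X → a = 0

lemma IsHomologySphere.of_homotopyEquiv {k : ℕ} (hX : IsHomologySphere k X) (f : C(X, Y))
    (g : C(Y, X)) (hgf : (g.comp f).Homotopic (ContinuousMap.id X))
    (hfg : (f.comp g).Homotopic (ContinuousMap.id Y)) : IsHomologySphere k Y := by
  obtain ⟨z, hz, h1, h2⟩ := hX
  refine ⟨push f z, hz.map f, fun y hy => ?_, fun a ha => h2 a ?_⟩
  · obtain ⟨a, ha⟩ := h1 _ (hy.map g)
    refine ⟨a, ?_⟩
    have := sub_mem (push_mem_boundaries f ha) (push_sub_push_mem_boundaries hfg hy.1)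
    simpa [push_push] using this
  · have := sub_mem (push_mem_boundaries g ha)
      (push_sub_push_mem_boundaries hgf (hz.1.zsmul a))
    simpa [push_push] using this

/-! ### The Mayer-Vietoris argument for a cover by two contractible open sets -/

/-- Let `r` keep the singular simplices lying in `A` and discard the others. It fixes chains from
`A` and takes chains from `B` to chains in `A ∩ B`. -/
lemma exists_push_inter {k : ℕ} {A B : Set X} {a : Chain k A} {b : Chain k B}
    (h : push (incl A) a = push (incl B) b) :
    ∃ c : Chain k (A ∩ B : Set X), push (inclOfLE Set.inter_subset_left) c = a ∧
      push (inclOfLE Set.inter_subset_right) c = b := by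
  classical
  let r : Chain k X →+ Chain k X :=
    chainLift fun s => if ∀ t, s t ∈ A then simp1 s else 0
  have hA : r.comp (push (incl A)) = push (incl A) := chain_hom_ext fun s => by
    have : ∀ t, (incl A).comp s t ∈ A := fun t => (s t).2
    rw [AddMonoidHom.comp_apply, push_simp1, chainLift_simp1, if_pos this]
  have hB (b : Chain k B) : r (push (incl B) b) ∈ (push (k := k) (incl (A ∩ B))).range := by
    induction b using chain_induction with
    | simp1 s =>
      rw [push_simp1, chainLift_simp1]
      split_ifs with hs
      · exact simp1_mem_range _ fun t => ⟨hs t, (s t).2⟩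
      · exact zero_mem _
    | zero => simp
    | add x y hx hy => rw [map_add, map_add]; exact add_mem hx hy
    | neg x hx => rw [map_neg, map_neg]; exact neg_mem hx
  obtain ⟨c, hc⟩ := hB b
  rw [← h, ← AddMonoidHom.comp_apply, hA] at hc
  refine ⟨c, push_injective (incl A) Subtype.val_injective ?_,
    push_injective (incl B) Subtype.val_injective ?_⟩
  · rw [push_push, ← hc]
    rfl
  · rw [push_push, ← h, ← hc]
    rfl

section MayerVietoris

variable {A B : Set X} {k : ℕ}

/-- The chains `a` in `A` and `b` in `B` both bound the chain `y` in `A ∩ B`. -/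
structure Bounds (a : Chain (k + 1) A) (b : Chain (k + 1) B) (y : Chain k (A ∩ B : Set X)) :
    Prop where
  left : bd a = push (inclOfLE Set.inter_subset_left) y
  right : bd b = push (inclOfLE Set.inter_subset_right) y

lemma Bounds.isCycle {a : Chain (k + 1) A} {b : Chain (k + 1) B} {y : Chain k (A ∩ B : Set X)}
    (h : Bounds a b y) : IsCycle (push (incl A) a - push (incl B) b) := by
  change bd _ = 0
  rw [map_sub, bd_push, bd_push, h.left, h.right, push_push, push_push]
  exact sub_self _

lemma Bounds.isReducedCycle {a : Chain (k + 1) A} {b : Chain (k + 1) B}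
    {y : Chain k (A ∩ B : Set X)} (h : Bounds a b y) : IsReducedCycle y := by
  refine ⟨IsCycle.of_map (inclOfLE Set.inter_subset_left) (Set.inclusion_injective Set.inter_subset_left) ?_,
    push (toPt A) a, ?_⟩
  · rw [← h.left]
    exact isCycle_bd a
  · rw [bd_push, h.left, push_push]
    rfl

lemma Bounds.sub_zsmul {a a' : Chain (k + 1) A} {b b' : Chain (k + 1) B}
    {y y' : Chain k (A ∩ B : Set X)} (h : Bounds a b y) (h' : Bounds a' b' y') (m : ℤ) :
    Bounds (a - m • a') (b - m • b') (y - m • y') :=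
  ⟨by simp [h.left, h'.left], by simp [h.right, h'.right]⟩

lemma Bounds.zsmul {a : Chain (k + 1) A} {b : Chain (k + 1) B}
    {y : Chain k (A ∩ B : Set X)} (h : Bounds a b y) (m : ℤ) :
    Bounds (m • a) (m • b) (m • y) :=
  ⟨by simp [h.left], by simp [h.right]⟩

/-- If `y` is the boundary of `e` in `A ∩ B`, then `a - e` and `b - e` are cycles in contractible
sets, hence boundaries; the two copies of `e` cancel in `X`. This is injectivity of the
Mayer-Vietoris connecting map. -/
lemma Bounds.mem_boundaries [ContractibleSpace A] [ContractibleSpace B] {a : Chain (k + 1) A}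
    {b : Chain (k + 1) B} {y : Chain k (A ∩ B : Set X)} (h : Bounds a b y)
    (hy : y ∈ boundaries k (A ∩ B : Set X)) :
    push (incl A) a - push (incl B) b ∈ boundaries (k + 1) X := by
  obtain ⟨e, rfl⟩ := hy
  have ha : IsCycle (a - push (inclOfLE Set.inter_subset_left) e) := by
    change bd _ = 0
    rw [map_sub, h.left, bd_push, sub_self]
  have hb : IsCycle (b - push (inclOfLE Set.inter_subset_right) e) := by
    change bd _ = 0
    rw [map_sub, h.right, bd_push, sub_self]
  have := sub_mem (push_mem_boundaries (incl A) ha.isReducedCycle.mem_boundaries)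
    (push_mem_boundaries (incl B) hb.isReducedCycle.mem_boundaries)
  rw [map_sub, map_sub, push_push, push_push] at this
  convert this using 1
  rw [show (incl A).comp (inclOfLE (Set.inter_subset_left (t := B))) =
    (incl B).comp (inclOfLE Set.inter_subset_right) from rfl]
  abel

/-- Replace a filling by a small one, a' + b'. Then a - ∂a' = b + ∂b' lies in both `A` and `B`, and
as a chain in `A ∩ B` it has boundary `y`. So the connecting map is well defined. -/
lemma Bounds.mem_boundaries_inter (hA : IsOpen A) (hB : IsOpen B) (hAB : A ∪ B = Set.univ)
    {a : Chain (k + 1) A} {b : Chain (k + 1) B} {y : Chain k (A ∩ B : Set X)} (h : Bounds a b y)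
    (hz : push (incl A) a - push (incl B) b ∈ boundaries (k + 1) X) :
    y ∈ boundaries k (A ∩ B : Set X) := by
  obtain ⟨c, hc⟩ := hz
  obtain ⟨e, he⟩ := exists_sub_bd_mem_small hA hB hAB c (by
    rw [hc]
    exact sub_mem (AddSubgroup.mem_sup_left ⟨_, rfl⟩) (AddSubgroup.mem_sup_right ⟨_, rfl⟩))
  obtain ⟨_, ⟨a', rfl⟩, _, ⟨b', rfl⟩, h'⟩ := AddSubgroup.mem_sup.1 he
  have h2 : push (incl A) (a - bd a') = push (incl B) (b + bd b') := by
    have h3 := congrArg bd h'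
    rw [map_sub, bd_bd, sub_zero, hc, map_add, bd_push, bd_push] at h3
    rw [map_sub, map_add, sub_eq_iff_eq_add, add_assoc, add_comm (push _ (bd b')), h3]
    abel
  obtain ⟨f, hf, -⟩ := exists_push_inter h2
  refine ⟨f, push_injective (inclOfLE Set.inter_subset_left) (Set.inclusion_injective Set.inter_subset_left) ?_⟩
  rw [← bd_push, hf, map_sub, bd_bd, sub_zero, h.left]

/-- Subdivision splits a cycle into a part in `A` and a part in `B` with opposite boundaries;
negating the second makes both bound the same `y`. -/
lemma exists_bounds (hA : IsOpen A) (hB : IsOpen B) (hAB : A ∪ B = Set.univ)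
    {z : Chain (k + 1) X} (hz : IsCycle z) :
    ∃ (a : Chain (k + 1) A) (b : Chain (k + 1) B) (y : Chain k (A ∩ B : Set X)), Bounds a b y ∧
      z - (push (incl A) a - push (incl B) b) ∈ boundaries (k + 1) X := by
  have hz : bd z = 0 := hz
  obtain ⟨e, he⟩ := exists_sub_bd_mem_small hA hB hAB z (by rw [hz]; exact zero_mem _)
  obtain ⟨_, ⟨a, rfl⟩, _, ⟨b, rfl⟩, h⟩ := AddSubgroup.mem_sup.1 he
  have h1 : push (incl A) (bd a) = push (incl B) (bd (-b)) := by
    have := congrArg bd h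
    rw [map_sub, bd_bd, sub_zero, hz, map_add, bd_push, bd_push] at this
    rw [map_neg, map_neg]
    exact eq_neg_of_add_eq_zero_left this
  obtain ⟨y, hy, hy'⟩ := exists_push_inter h1
  refine ⟨a, -b, y, ⟨hy.symm, hy'.symm⟩, e, ?_⟩
  rw [map_neg, sub_neg_eq_add, h, sub_sub_cancel]

/-- Suspension raises the degree of a homology sphere by one. -/
theorem IsHomologySphere.of_cover [ContractibleSpace A] [ContractibleSpace B] (hA : IsOpen A)
    (hB : IsOpen B) (hAB : A ∪ B = Set.univ) (h : IsHomologySphere k (A ∩ B : Set X)) :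
    IsHomologySphere (k + 1) X := by
  obtain ⟨y, hy, h1, h2⟩ := h
  -- The generator of `A ∩ B` bounds in each contractible half; the difference of the two fillings
  -- is the new generator.
  obtain ⟨a, ha⟩ := (hy.map (inclOfLE Set.inter_subset_left : C(_, A))).mem_boundaries
  obtain ⟨b, hb⟩ := (hy.map (inclOfLE Set.inter_subset_right : C(_, B))).mem_boundaries
  have hab : Bounds a b y := ⟨ha, hb⟩
  refine ⟨_, hab.isCycle.isReducedCycle, fun z hz => ?_, fun m hm => h2 m ?_⟩
  · obtain ⟨a', b', y', hab', hz'⟩ := exists_bounds hA hB hAB hz.1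
    obtain ⟨m, hm⟩ := h1 y' hab'.isReducedCycle
    refine ⟨m, ?_⟩
    convert add_mem hz' ((hab'.sub_zsmul hab m).mem_boundaries hm) using 1
    simp only [map_sub, map_zsmul, smul_sub]
    abel
  · refine (hab.zsmul m).mem_boundaries_inter hA hB hAB ?_
    simpa [smul_sub] using hm

/-- A map exchanging the two halves of a suspension and homotopic to the identity on their
intersection acts by `-1`. -/
theorem add_push_mem_boundaries_of_swap [ContractibleSpace A] [ContractibleSpace B] (hA : IsOpen A)
    (hB : IsOpen B) (hAB : A ∪ B = Set.univ) (r : C(X, X)) (rA : C(A, B)) (rB : C(B, A))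
    (rI : C((A ∩ B : Set X), (A ∩ B : Set X))) (hrA : ∀ x, (rA x : X) = r x)
    (hrB : ∀ x, (rB x : X) = r x) (hrI : ∀ x, (rI x : X) = r x)
    (hr : rI.Homotopic (ContinuousMap.id _)) {z : Chain (k + 1) X} (hz : IsCycle z) :
    z + push r z ∈ boundaries (k + 1) X := by
  obtain ⟨a, b, y, hab, h⟩ := exists_bounds hA hB hAB hz
  have e1 : (inclOfLE (Set.inter_subset_left (t := B))).comp rI =
      rB.comp (inclOfLE Set.inter_subset_right) := by
    ext x
    exact (hrI x).trans (hrB (Set.inclusion Set.inter_subset_right x)).symm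
  have e2 : (inclOfLE (Set.inter_subset_right (s := A))).comp rI =
      rA.comp (inclOfLE Set.inter_subset_left) := by
    ext x
    exact (hrI x).trans (hrA (Set.inclusion Set.inter_subset_left x)).symm
  -- With z homologous to a - b, the sum z + r z is homologous to (a - r b) - (b - r a). This pair
  -- bounds y - r y, which is null-homologous since `rI` is homotopic to the identity.
  have hab' : Bounds (a - push rB b) (b - push rA a) (y - push rI y) := by
    constructor
    · rw [map_sub, map_sub, hab.left, bd_push, hab.right, push_push, push_push, e1]
    · rw [map_sub, map_sub, hab.right, bd_push, hab.left, push_push, push_push, e2]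
  have h1 := hab'.mem_boundaries (by
    simpa using neg_mem (push_sub_push_mem_boundaries hr hab.isReducedCycle.1))
  have hA' : (incl B).comp rA = r.comp (incl A) := by ext x; exact hrA x
  have hB' : (incl A).comp rB = r.comp (incl B) := by ext x; exact hrB x
  convert add_mem (add_mem h (push_mem_boundaries r h)) h1 using 1
  simp only [map_sub, push_push, hA', hB']
  abel

end MayerVietoris

/-! ### The homology of spheres -/

/-- Every path is constant, so its two endpoints cancel. -/
lemma boundaries_zero_eq_bot [TotallyDisconnectedSpace X] : boundaries 0 X = ⊥ := by
  have : (bd : Chain 1 X →+ Chain 0 X) = 0 := chain_hom_ext fun s => by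
    have h (f g : C(Simplex 0, Simplex 1)) : s.comp f = s.comp g := by
      ext t
      exact (isPreconnected_univ.image s s.continuous.continuousOn).subsingleton
        ⟨_, Set.mem_univ _, rfl⟩ ⟨_, Set.mem_univ _, rfl⟩
    simp [bd_simp1, Fin.sum_univ_two, h (face 1) (face 0)]
  rw [boundaries, this]
  exact AddMonoidHom.range_zero

lemma isHomologySphere_zero [TotallyDisconnectedSpace X] (p q : X) (hpq : p ≠ q)
    (h : ∀ x, x = p ∨ x = q) : IsHomologySphere 0 X := by
  classical
  let c (x : X) : Chain 0 X := simp1 (ContinuousMap.const _ x)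
  have hc (y : Chain 0 X) : ∃ a b : ℤ, y = a • c p + b • c q := by
    induction y using chain_induction with
    | simp1 s =>
      have hs : s = ContinuousMap.const _ (s default) := by
        ext t
        rw [Subsingleton.elim t default]
        rfl
      rcases h (s default) with h | h
      · exact ⟨1, 0, by rw [hs, h]; simp [c]⟩
      · exact ⟨0, 1, by rw [hs, h]; simp [c]⟩
    | zero => exact ⟨0, 0, by simp⟩
    | add x y hx hy =>
      obtain ⟨a, b, rfl⟩ := hx
      obtain ⟨a', b', rfl⟩ := hy
      exact ⟨a + a', b + b', by rw [add_smul, add_smul]; abel⟩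
    | neg x hx =>
      obtain ⟨a, b, rfl⟩ := hx
      exact ⟨-a, -b, by rw [neg_smul, neg_smul]; abel⟩
  have hpush (x : X) : push (toPt X) (c x) = simp1 (ContinuousMap.const _ ()) := push_simp1 _ _
  refine ⟨c p - c q, ⟨trivial, ?_⟩, fun y hy => ?_, fun a ha => ?_⟩
  · rw [map_sub, hpush, hpush, sub_self]
    exact zero_mem _
  · obtain ⟨a, b, rfl⟩ := hc y
    have h1 := hy.2
    rw [boundaries_zero_eq_bot, AddSubgroup.mem_bot, map_add, map_zsmul, map_zsmul, hpush, hpush]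
      at h1
    -- The augmentation shows that the two coefficients of a reduced cycle add up to zero.
    have h2 := congrArg (chainLift fun _ => (1 : ℤ)) h1
    simp only [map_add, map_zsmul, chainLift_simp1, map_zero, smul_eq_mul, mul_one] at h2
    refine ⟨a, ?_⟩
    rw [eq_neg_of_add_eq_zero_right h2, neg_smul, smul_sub]
    convert zero_mem (boundaries 0 X) using 1
    abel
  · rw [boundaries_zero_eq_bot, AddSubgroup.mem_bot] at ha
    -- This functional reads off the coefficient of `p`.
    have h2 := congrArg (chainLift fun s => if s default = p then (1 : ℤ) else 0) ha
    simpa [c, hpq.symm] using h2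

/-! ### Punctured unit spheres -/

variable {F : Type} [NormedAddCommGroup F] [InnerProductSpace ℝ F]

/-- The unit sphere. -/
abbrev USphere (F : Type) [NormedAddCommGroup F] : Type := {u : F // ‖u‖ = 1}

/-- The normalization of a nowhere vanishing map. -/
def normalized (f : C(Y, F)) (h : ∀ y, f y ≠ 0) : C(Y, USphere F) where
  toFun y := ⟨‖f y‖⁻¹ • f y, by
    rw [norm_smul, norm_inv, norm_norm, inv_mul_cancel₀ (norm_ne_zero_iff.2 (h y))]⟩
  continuous_toFun := by
    refine Continuous.subtype_mk (Continuous.smul (Continuous.inv₀ (by fun_prop) fun y => ?_)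
      (by fun_prop)) _
    exact norm_ne_zero_iff.2 (h y)

lemma normalized_eq {f : C(Y, F)} (h : ∀ y, f y ≠ 0) {y : Y} (hy : ‖f y‖ = 1) :
    (normalized f h y).1 = f y := by
  change ‖f y‖⁻¹ • f y = f y
  rw [hy, inv_one, one_smul]

lemma eq_norm_smul_of_normalized_eq {f : C(Y, F)} (h : ∀ y, f y ≠ 0) {y : Y} {v : F}
    (hv : (normalized f h y).1 = v) : f y = ‖f y‖ • v := by
  rw [← hv]
  change _ = _ • ‖f y‖⁻¹ • f y
  rw [smul_smul, mul_inv_cancel₀ (norm_ne_zero_iff.2 (h y)), one_smul]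

lemma ne_neg_of_norm_eq_one {m : F} (hm : ‖m‖ = 1) : m ≠ -m := fun h => by
  have h2 : (2 : ℝ) • m = 0 := by
    rw [two_smul]
    exact eq_neg_iff_add_eq_zero.1 h
  have : m = 0 := (smul_eq_zero.1 h2).resolve_left two_ne_zero
  simp [this] at hm

/-- The unit sphere with a point removed. -/
def avoid (v : F) : Set (USphere F) := {x | x.1 ≠ v}

lemma isOpen_avoid {F : Type} [NormedAddCommGroup F] (v : F) : IsOpen (avoid v) :=
  isOpen_ne.preimage continuous_subtype_val

/-- A meeting point gives (1 - t)x = (c + t)v with unit vectors `x`, `v`, so the coefficients agree: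
either x = v or 1 - t = c + t = 0, which is impossible. The case c = 0 allows normalization of the
segment from `x` to `-v`; the other values keep the result away from `v`. -/
lemma slide_ne {x v : F} (hx : ‖x‖ = 1) (hv : ‖v‖ = 1) (hxv : x ≠ v) {t c : ℝ} (ht : 0 ≤ t)
    (ht' : t ≤ 1) (hc : 0 ≤ c) : (1 - t) • x + t • (-v) ≠ c • v := by
  intro h
  have h1 : (1 - t) • x = (c + t) • v := by
    rw [add_smul, ← h, smul_neg]
    abel
  have h2 := congrArg norm h1
  rw [norm_smul, norm_smul, hx, hv, mul_one, mul_one, Real.norm_of_nonneg (by linarith),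
    Real.norm_of_nonneg (by linarith)] at h2
  rw [← h2] at h1
  rcases eq_or_ne (1 - t) 0 with h3 | h3
  · linarith
  · exact hxv (smul_right_injective F h3 h1)

lemma contractibleSpace_avoid {v : F} (hv : ‖v‖ = 1) : ContractibleSpace (avoid v) := by
  rw [contractible_iff_id_nullhomotopic]
  have hv' : -v ≠ v := (ne_neg_of_norm_eq_one hv).symm
  let h : C(unitInterval × avoid v, F) :=
    ⟨fun q => (1 - q.1.1) • q.2.1.1 + q.1.1 • (-v), by fun_prop⟩
  have hne : ∀ q (c : ℝ), 0 ≤ c → h q ≠ c • v := fun q c hc =>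
    slide_ne q.2.1.2 hv q.2.2 q.1.2.1 q.1.2.2 hc
  have h0 : ∀ q, h q ≠ 0 := fun q => by simpa using hne q 0 le_rfl
  refine ⟨⟨⟨-v, by rw [norm_neg, hv]⟩, hv'⟩, ⟨
    { toFun := fun q => ⟨normalized h h0 q, fun hq =>
        hne q _ (norm_nonneg _) (eq_norm_smul_of_normalized_eq h0 hq)⟩
      continuous_toFun := by fun_prop
      map_zero_left := fun x => ?_
      map_one_left := fun x => ?_ }⟩⟩
  · have e : h (0, x) = x.1.1 := by simp [h]
    apply Subtype.ext
    apply Subtype.ext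
    exact (normalized_eq h0 (by rw [e, x.1.2])).trans e
  · have e : h (1, x) = -v := by simp [h]
    apply Subtype.ext
    apply Subtype.ext
    exact (normalized_eq h0 (by rw [e, norm_neg, hv])).trans e

/-- The line spanned by `m` meets the unit sphere only in `m` and `-m`, both removed, so translates
along `m` never reach that line. -/
lemma shift_ne {m : F} (hm : ‖m‖ = 1) (x : (avoid (-m) ∩ avoid m : Set (USphere F))) (s c : ℝ) :
    x.1.1 - s • m ≠ c • m := by
  intro h
  have h1 : x.1.1 = (c + s) • m := by
    rw [add_smul, ← h]
    abel
  have h2 := x.1.2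
  rw [h1, norm_smul, hm, mul_one, Real.norm_eq_abs] at h2
  rcases eq_or_eq_neg_of_abs_eq h2 with h3 | h3
  · exact x.2.2 (by rw [h1, h3, one_smul])
  · exact x.2.1 (by rw [h1, h3, neg_one_smul])

/-- The self-map of the twice punctured sphere given by translation in the direction of `m`
followed by normalization. -/
def shift {m : F} (hm : ‖m‖ = 1) (s : C(Y, ℝ))
    (f : C(Y, (avoid (-m) ∩ avoid m : Set (USphere F)))) :
    C(Y, (avoid (-m) ∩ avoid m : Set (USphere F))) :=
  let g : C(Y, F) := ⟨fun y => (f y).1.1 - s y • m, by fun_prop⟩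
  have hg : ∀ y, g y ≠ 0 := fun y => by
    rw [← zero_smul ℝ m]
    exact shift_ne hm (f y) (s y) 0
  ⟨fun y => ⟨normalized g hg y,
    fun h => by
      have h2 : g y = _ := eq_norm_smul_of_normalized_eq hg h
      rw [smul_neg, ← neg_smul] at h2
      exact shift_ne hm (f y) (s y) _ h2,
    fun h => by
      have h2 : g y = _ := eq_norm_smul_of_normalized_eq hg h
      exact shift_ne hm (f y) (s y) _ h2⟩, by fun_prop⟩

lemma shift_eq {m : F} (hm : ‖m‖ = 1) (s : C(Y, ℝ))
    (f : C(Y, (avoid (-m) ∩ avoid m : Set (USphere F)))) {y : Y}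
    (h : ‖(f y).1.1 - s y • m‖ = 1) : (shift hm s f y).1.1 = (f y).1.1 - s y • m :=
  normalized_eq (f := ⟨fun y => (f y).1.1 - s y • m, by fun_prop⟩) _ h

/-- Scale the translation down to zero. The shift by ⟨m, x⟩ is the retraction to the equator, the
shift by 2⟨m, x⟩ the reflection. -/
lemma shift_homotopic_id {m : F} (hm : ‖m‖ = 1)
    (s : C((avoid (-m) ∩ avoid m : Set (USphere F)), ℝ)) :
    (shift hm s (ContinuousMap.id _)).Homotopic (ContinuousMap.id _) := by
  let H := shift hm (⟨fun q => (1 - q.1.1) * s q.2, by fun_prop⟩ :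
    C(unitInterval × (avoid (-m) ∩ avoid m : Set (USphere F)), ℝ)) ContinuousMap.snd
  refine ⟨{ toFun := H, continuous_toFun := H.continuous, map_zero_left := fun x => ?_,
            map_one_left := fun x => ?_ }⟩
  · apply Subtype.ext
    apply Subtype.ext
    change ‖x.1.1 - ((1 - 0) * s x) • m‖⁻¹ • (x.1.1 - ((1 - 0) * s x) • m) =
      ‖x.1.1 - s x • m‖⁻¹ • (x.1.1 - s x • m)
    rw [sub_zero, one_mul]
  · apply Subtype.ext
    apply Subtype.ext
    change ‖x.1.1 - ((1 - 1) * s x) • m‖⁻¹ • (x.1.1 - ((1 - 1) * s x) • m) = x.1.1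
    rw [sub_self, zero_mul, zero_smul, sub_zero, x.1.2, inv_one, one_smul]

lemma avoid_union {m : F} (hm : ‖m‖ = 1) : avoid (-m) ∪ avoid m = Set.univ := by
  refine Set.eq_univ_of_forall fun x => ?_
  by_contra h
  simp only [avoid, Set.mem_union, Set.mem_ofPred_eq, not_or, not_not] at h
  exact ne_neg_of_norm_eq_one hm (h.2.symm.trans h.1)

/-- The twice punctured sphere retracts onto its equator by dropping the `m`-component and
normalizing. -/
lemma isHomologySphere_inter {k : ℕ} {m : F} (hm : ‖m‖ = 1)
    (h : IsHomologySphere k (USphere (Submodule.span ℝ {m})ᗮ)) :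
    IsHomologySphere k (avoid (-m) ∩ avoid m : Set (USphere F)) := by
  have hmem (x : F) : x - inner ℝ m x • m ∈ (Submodule.span ℝ {m})ᗮ := by
    rw [Submodule.mem_orthogonal_singleton_iff_inner_right, inner_sub_right, inner_smul_right,
      real_inner_self_eq_norm_sq, hm]
    ring
  have hin (y : (Submodule.span ℝ {m})ᗮ) : inner ℝ m (y : F) = 0 :=
    Submodule.mem_orthogonal_singleton_iff_inner_right.1 y.2
  let f : C(USphere (Submodule.span ℝ {m})ᗮ, (avoid (-m) ∩ avoid m : Set (USphere F))) :=
    ⟨fun y => ⟨⟨y.1.1, y.2⟩, fun h => by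
        have h' : y.1.1 = -m := h
        have := hin y.1
        rw [h', inner_neg_right, real_inner_self_eq_norm_sq, hm] at this
        norm_num at this, fun h => by
        have h' : y.1.1 = m := h
        have := hin y.1
        rw [h', real_inner_self_eq_norm_sq, hm] at this
        norm_num at this⟩, by fun_prop⟩
  let s : C((avoid (-m) ∩ avoid m : Set (USphere F)), ℝ) := ⟨fun x => inner ℝ m x.1.1, by fun_prop⟩
  let g' : C((avoid (-m) ∩ avoid m : Set (USphere F)), (Submodule.span ℝ {m})ᗮ) :=
    ⟨fun x => ⟨x.1.1 - inner ℝ m x.1.1 • m, hmem _⟩, by fun_prop⟩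
  have hg' : ∀ x, g' x ≠ 0 := fun x hx => by
    have : x.1.1 - inner ℝ m x.1.1 • m = 0 := congrArg Subtype.val hx
    exact shift_ne hm x _ 0 (by simpa using this)
  refine h.of_homotopyEquiv f (normalized g' hg') ?_ ?_
  · have : (normalized g' hg').comp f = ContinuousMap.id _ := by
      ext1 y
      have e : g' (f y) = y.1 := by
        apply Subtype.ext
        change y.1.1 - inner ℝ m y.1.1 • m = y.1.1
        rw [hin, zero_smul, sub_zero]
      apply Subtype.ext
      exact (normalized_eq hg' (by rw [e, y.2])).trans e
    rw [this]
  · exact shift_homotopic_id hm s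

/-- The reduced homology of the unit sphere of a space of dimension `k + 1` is infinite cyclic in
degree `k`. -/
theorem isHomologySphere_USphere (k : ℕ) (F : Type) [NormedAddCommGroup F] [InnerProductSpace ℝ F]
    (hF : Module.finrank ℝ F = k + 1) : IsHomologySphere k (USphere F) := by
  induction k generalizing F with
  | zero =>
    have : Nontrivial F := Module.nontrivial_of_finrank_pos (R := ℝ) (by omega)
    obtain ⟨m, hm⟩ := exists_norm_eq F zero_le_one
    have hne : m ≠ 0 := fun h => by simp [h] at hm
    have h (x : USphere F) : x = ⟨m, hm⟩ ∨ x = ⟨-m, by rw [norm_neg, hm]⟩ := by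
      obtain ⟨c, hc⟩ := (finrank_eq_one_iff_of_nonzero' m hne).1 hF x.1
      have h2 := x.2
      rw [← hc, norm_smul, hm, mul_one, Real.norm_eq_abs] at h2
      rcases eq_or_eq_neg_of_abs_eq h2 with h3 | h3
      · exact Or.inl (Subtype.ext (by rw [← hc, h3, one_smul]))
      · exact Or.inr (Subtype.ext (by rw [← hc, h3, neg_one_smul]))
    have : Finite (USphere F) := Finite.of_surjective
      (fun b : Bool => if b then (⟨m, hm⟩ : USphere F) else ⟨-m, by rw [norm_neg, hm]⟩) fun x => by
        rcases h x with h | h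
        · exact ⟨true, h.symm⟩
        · exact ⟨false, h.symm⟩
    have hd : DiscreteTopology (USphere F) := inferInstance
    refine isHomologySphere_zero _ _ (fun h => ?_) h
    exact ne_neg_of_norm_eq_one hm (congrArg Subtype.val h)
  | succ k ih =>
    have : Nontrivial F := Module.nontrivial_of_finrank_pos (R := ℝ) (by omega)
    obtain ⟨m, hm⟩ := exists_norm_eq F zero_le_one
    have hne : m ≠ 0 := fun h => by simp [h] at hm
    have : Fact (Module.finrank ℝ F = k + 1 + 1) := ⟨hF⟩
    have hI := isHomologySphere_inter hm (ih _ (Submodule.finrank_orthogonal_span_singleton hne))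
    have := contractibleSpace_avoid hm
    have := contractibleSpace_avoid (v := -m) (by rw [norm_neg, hm])
    exact hI.of_cover (isOpen_avoid _) (isOpen_avoid _) (avoid_union hm)

/-! ### Reflections and the antipodal map -/

lemma norm_sub_two_inner_smul {m : F} (hm : ‖m‖ = 1) (x : F) :
    ‖x - (2 * inner ℝ m x) • m‖ = ‖x‖ := by
  have : ‖x - (2 * inner ℝ m x) • m‖ ^ 2 = ‖x‖ ^ 2 := by
    rw [norm_sub_sq_real, inner_smul_right, norm_smul, hm, mul_one, Real.norm_eq_abs, sq_abs,
      real_inner_comm]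
    ring
  exact (pow_left_inj₀ (norm_nonneg _) (norm_nonneg _) two_ne_zero).1 this

/-- The reflection of the unit sphere in the hyperplane orthogonal to `m`. -/
def reflect {m : F} (hm : ‖m‖ = 1) : C(USphere F, USphere F) :=
  ⟨fun x => ⟨x.1 - (2 * inner ℝ m x.1) • m, by rw [norm_sub_two_inner_smul hm, x.2]⟩, by fun_prop⟩

lemma sub_two_inner_smul_eq_iff {m : F} (hm : ‖m‖ = 1) {x : F} (c : ℝ) :
    x - (2 * inner ℝ m x) • m = c • m ↔ x = (-c) • m := by
  constructor
  · intro h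
    have h1 := congrArg (inner ℝ m) h
    rw [inner_sub_right, inner_smul_right, inner_smul_right, real_inner_self_eq_norm_sq, hm] at h1
    rw [sub_eq_iff_eq_add, ← add_smul] at h
    have : inner ℝ m x = -c := by linarith
    rw [this] at h
    rw [h]
    congr 1
    ring
  · rintro h
    rw [h, inner_smul_right, real_inner_self_eq_norm_sq, hm, ← sub_smul]
    congr 1
    ring

/-- A reflection acts by `-1` on the homology of the sphere. -/
theorem add_push_reflect_mem_boundaries {m : F} (hm : ‖m‖ = 1) {k : ℕ}
    {z : Chain (k + 1) (USphere F)} (hz : IsCycle z) :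
    z + push (reflect hm) z ∈ boundaries (k + 1) (USphere F) := by
  have := contractibleSpace_avoid hm
  have := contractibleSpace_avoid (v := -m) (by rw [norm_neg, hm])
  have h1 (x : USphere F) : (reflect hm x).1 = m ↔ x.1 = -m := by
    simpa using! sub_two_inner_smul_eq_iff hm (x := x.1) 1
  have h2 (x : USphere F) : (reflect hm x).1 = -m ↔ x.1 = m := by
    simpa using! sub_two_inner_smul_eq_iff hm (x := x.1) (-1)
  let s : C((avoid (-m) ∩ avoid m : Set (USphere F)), ℝ) :=
    ⟨fun x => 2 * inner ℝ m x.1.1, by fun_prop⟩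
  refine add_push_mem_boundaries_of_swap (isOpen_avoid (-m)) (isOpen_avoid m) (avoid_union hm)
    (reflect hm) ⟨fun x => ⟨reflect hm x, fun h => x.2 ((h1 x).1 h)⟩, by fun_prop⟩
    ⟨fun x => ⟨reflect hm x, fun h => x.2 ((h2 x).1 h)⟩, by fun_prop⟩ _
    (fun _ => rfl) (fun _ => rfl) (fun x => ?_) (shift_homotopic_id hm s) hz
  apply Subtype.ext
  refine shift_eq hm s (ContinuousMap.id _) ?_
  exact (norm_sub_two_inner_smul hm x.1.1).trans x.1.2

/-- The antipodal map of `S^n`. -/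
def antip (n : ℕ) : C(S n, S n) := ⟨antipode, by unfold antipode; fun_prop⟩

/-- The antipodal map of `S^n` acts by `(-1)^(n+1)` on homology. -/
theorem push_antip_sub_mem_boundaries (n : ℕ) {k : ℕ} {z : Chain (k + 1) (S n)}
    (hz : IsCycle z) : push (antip n) z - (-1 : ℤ) ^ (n + 1) • z ∈ boundaries (k + 1) (S n) := by
  -- The map `f` negates the first `j` coordinates; each further coordinate reflection changes the
  -- sign of the action.
  have key (j : ℕ) (hj : j ≤ n + 1) : ∃ f : C(S n, S n),
      (∀ x i, (f x).1 i = if (i : ℕ) < j then -x.1 i else x.1 i) ∧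
        push f z - (-1 : ℤ) ^ j • z ∈ boundaries (k + 1) (S n) := by
    induction j with
    | zero => exact ⟨ContinuousMap.id _, fun x i => by simp, by simp⟩
    | succ j ih =>
      obtain ⟨f, hf, h⟩ := ih (by omega)
      have hm : ‖(EuclideanSpace.single (⟨j, by omega⟩ : Fin (n + 1)) (1 : ℝ) : E n)‖ = 1 := by simp
      refine ⟨(reflect hm).comp f, fun x i => ?_, ?_⟩
      · change ((f x).1 - (2 * inner ℝ _ (f x).1) • _) i = _
        rw [EuclideanSpace.inner_single_left]
        simp only [PiLp.sub_apply, PiLp.smul_apply, hf, lt_irrefl, if_false]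
        rcases lt_trichotomy (i : ℕ) j with hi | hi | hi
        · have : i ≠ ⟨j, by omega⟩ := fun h => by simp [h] at hi
          simp [hi, this, Nat.lt_succ_of_lt hi]
        · have : i = ⟨j, by omega⟩ := Fin.ext hi
          subst hi
          simp
          ring
        · have : i ≠ ⟨j, by omega⟩ := fun h => by simp [h] at hi
          simp [this, not_lt.2 hi.le, show ¬ (i : ℕ) < j + 1 by omega]
      · have h1 := add_push_reflect_mem_boundaries hm (hz.map f)
        rw [← push_push]
        convert sub_mem h1 h using 1
        rw [pow_succ]
        simp only [mul_neg, mul_one, neg_smul]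
        abel
  obtain ⟨f, hf, h⟩ := key (n + 1) le_rfl
  have : f = antip n := by
    ext x i
    rw [hf, if_pos i.2]
    rfl
  rwa [← this]

/-! ### Homology groups and the long exact sequence of a pair -/

lemma Represents.push {k : ℕ} (f : C(X, Y)) {z : Chain k X} {x : (absHomology k).obj (TopCat.of X)}
    (h : Represents (K := chains.obj (TopCat.of X)) z x) :
    Represents (K := chains.obj (TopCat.of Y)) (push f z)
      (((absHomology k).map (TopCat.ofHom f)).hom x) :=
  h.map (chains.map (TopCat.ofHom f))

/-- The element `g` freely generates the abelian group `M`. -/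
def IsFreeGenerator {M : Type} [AddCommGroup M] (g : M) : Prop :=
  (∀ x : M, ∃ a : ℤ, x = a • g) ∧ ∀ a : ℤ, a • g = 0 → a = 0

lemma Represents.eq_zero {k : ℕ} {z : Chain k X} {x : (absHomology k).obj (TopCat.of X)}
    (h : Represents (K := chains.obj (TopCat.of X)) z x) (hz : z ∈ boundaries k X) : x = 0 := by
  have h0 : Represents (K := chains.obj (TopCat.of X)) z 0 :=
    represents_zero_iff_mem_boundaries.2 hz
  obtain ⟨y, hy, rfl⟩ := h
  obtain ⟨y', hy', h0⟩ := h0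
  have hm : Function.Injective ((chains.obj (TopCat.of X)).iCycles k).hom :=
    (ModuleCat.mono_iff_injective _).1 inferInstance
  rw [hm (hy.trans hy'.symm)]
  exact h0

lemma Represents.sub_zsmul {k : ℕ} {y z : Chain k X} {x g : (absHomology k).obj (TopCat.of X)}
    (h : Represents (K := chains.obj (TopCat.of X)) y x)
    (h' : Represents (K := chains.obj (TopCat.of X)) z g) (a : ℤ) :
    Represents (K := chains.obj (TopCat.of X)) (y - a • z : Chain k X) (x - a • g) :=
  h.sub (h'.zsmul a)

lemma Represents.eq_zsmul {k : ℕ} {y z : Chain k X} {x g : (absHomology k).obj (TopCat.of X)}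
    (h : Represents (K := chains.obj (TopCat.of X)) y x)
    (h' : Represents (K := chains.obj (TopCat.of X)) z g) {a : ℤ}
    (hz : y - a • z ∈ boundaries k X) : x = a • g :=
  sub_eq_zero.1 ((h.sub_zsmul h' a).eq_zero hz)

lemma represents_of_eq {k : ℕ} {z : Chain k X} {x y : (absHomology k).obj (TopCat.of X)}
    (h : Represents (K := chains.obj (TopCat.of X)) z x) (hxy : x = y) :
    Represents (K := chains.obj (TopCat.of X)) z y := hxy ▸ h

lemma IsHomologySphere.exists_isFreeGenerator {k : ℕ} (h : IsHomologySphere (k + 1) X) :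
    ∃ g : (absHomology (k + 1)).obj (TopCat.of X), IsFreeGenerator g := by
  obtain ⟨z, hz, h1, h2⟩ := h
  obtain ⟨g, hg⟩ := hz.1.exists_represents
  refine ⟨g, fun x => ?_, fun a ha => h2 a ?_⟩
  · obtain ⟨y, hy⟩ := exists_represents x
    have hy : Represents (K := chains.obj (TopCat.of X)) y x := hy
    obtain ⟨a, ha⟩ := h1 y (IsCycle.isReducedCycle hy.isCycle)
    exact ⟨a, hy.eq_zsmul hg ha⟩
  · have h3 : Represents (K := chains.obj (TopCat.of X)) (a • z : Chain (k + 1) X) (a • g) :=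
      hg.zsmul a
    exact represents_zero_iff_mem_boundaries.1 (represents_of_eq h3 ha)

lemma absHomology_eq_zero [ContractibleSpace X] {k : ℕ}
    (x : (absHomology (k + 1)).obj (TopCat.of X)) : x = 0 := by
  obtain ⟨y, hy⟩ := exists_represents x
  have hy : Represents (K := chains.obj (TopCat.of X)) y x := hy
  exact hy.eq_zero hy.isCycle.isReducedCycle.mem_boundaries

lemma absHomology_map_eq {k : ℕ} {f g : C(X, Y)} (h : f.Homotopic g)
    (x : (absHomology k).obj (TopCat.of X)) :
    ((absHomology k).map (TopCat.ofHom f)).hom x = ((absHomology k).map (TopCat.ofHom g)).hom x := by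
  obtain ⟨H⟩ := h
  have H' : TopCat.Homotopy (TopCat.ofHom f) (TopCat.ofHom g) := H
  exact congrArg (fun m => ModuleCat.Hom.hom m x)
    (H'.congr_homologyMap_singularChainComplexFunctor (ModuleCat.of ℤ ℤ) k)

lemma absHomology_map_map {k : ℕ} (f : C(X, Y)) (g : C(Y, Z))
    (x : (absHomology k).obj (TopCat.of X)) :
    ((absHomology k).map (TopCat.ofHom g)).hom (((absHomology k).map (TopCat.ofHom f)).hom x) =
      ((absHomology k).map (TopCat.ofHom (g.comp f))).hom x :=
  (congrArg (fun m => ModuleCat.Hom.hom m x)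
    ((absHomology k).map_comp (TopCat.ofHom f) (TopCat.ofHom g))).symm

lemma absHomology_map_id {k : ℕ} (x : (absHomology k).obj (TopCat.of X)) :
    ((absHomology k).map (TopCat.ofHom (ContinuousMap.id X))).hom x = x :=
  congrArg (fun m => ModuleCat.Hom.hom m x) ((absHomology k).map_id (TopCat.of X))

/-- For even `n` the antipodal map is a product of an odd number of reflections. -/
lemma absHomology_map_antip (n : ℕ) (hn : Even n) {k : ℕ}
    (x : (absHomology (k + 1)).obj (TopCat.of (S n))) :
    ((absHomology (k + 1)).map (TopCat.ofHom (antip n))).hom x = -x := by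
  obtain ⟨z, hz⟩ := exists_represents x
  have hz : Represents (K := chains.obj (TopCat.of (S n))) z x := hz
  rw [(hz.push (antip n)).eq_zsmul hz (push_antip_sub_mem_boundaries n hz.isCycle),
    hn.add_one.neg_one_pow, neg_one_zsmul]

/-- The connecting homomorphism of a pair. -/
def connecting (k : ℕ) (P : TopPair.{0}) :
    (relHomology (k + 1)).obj P ⟶ (absHomology k).obj P.snd :=
  (pairSeq_shortExact P).δ (k + 1) k rfl

lemma exists_absToRel_eq {k : ℕ} {P : TopPair.{0}} {x : (relHomology (k + 1)).obj P}
    (h : (connecting k P).hom x = 0) : ∃ y, (absToRel (k + 1) P).hom y = x :=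
  (ShortComplex.moduleCat_exact_iff _).1
    ((pairSeq_shortExact P).homology_exact₃ (k + 1) k rfl) x h

lemma exists_connecting_eq {k : ℕ} {P : TopPair.{0}} {x : (absHomology k).obj P.snd}
    (h : ((absHomology k).map P.map).hom x = 0) : ∃ y, (connecting k P).hom y = x :=
  (ShortComplex.moduleCat_exact_iff _).1
    ((pairSeq_shortExact P).homology_exact₁ (k + 1) k rfl) x h

lemma exists_map_eq {k : ℕ} {P : TopPair.{0}} {x : (absHomology k).obj P.fst}
    (h : (absToRel k P).hom x = 0) : ∃ y, ((absHomology k).map P.map).hom y = x :=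
  (ShortComplex.moduleCat_exact_iff _).1 ((pairSeq_shortExact P).homology_exact₂ k) x h

lemma connecting_map {k : ℕ} {P Q : TopPair.{0}} (f : P ⟶ Q) (x : (relHomology (k + 1)).obj P) :
    (connecting k Q).hom (((relHomology (k + 1)).map f).hom x) =
      ((absHomology k).map (TopPair.Hom.snd f)).hom ((connecting k P).hom x) :=
  (congrArg (fun m => ModuleCat.Hom.hom m x) (HomologicalComplex.HomologySequence.δ_naturality
    (pairSeqMap f) (pairSeq_shortExact P) (pairSeq_shortExact Q) (k + 1) k rfl)).symm

lemma absToRel_map {k : ℕ} {P Q : TopPair.{0}} (f : P ⟶ Q) (x : (absHomology k).obj P.fst) :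
    ((relHomology k).map f).hom ((absToRel k P).hom x) =
      (absToRel k Q).hom (((absHomology k).map (TopPair.Hom.fst f)).hom x) := by
  have h := congrArg (fun m => (HomologicalComplex.homologyFunctor _ _ k).map m)
    (pairSeqMap f).comm₂₃
  simp only [Functor.map_comp] at h
  exact (congrArg (fun m => ModuleCat.Hom.hom m x) h).symm

lemma relHomology_map_map {k : ℕ} {P Q R : TopPair.{0}} (f : P ⟶ Q) (g : Q ⟶ R)
    (x : (relHomology k).obj P) :
    ((relHomology k).map g).hom (((relHomology k).map f).hom x) =
      ((relHomology k).map (f ≫ g)).hom x :=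
  (congrArg (fun m => ModuleCat.Hom.hom m x) ((relHomology k).map_comp f g)).symm

/-- Degree at least two ensures that the connecting map also lands in positive degree, where a
contractible subspace has no homology. -/
lemma relHomology_eq_zero {k : ℕ} {P : TopPair.{0}} [ContractibleSpace P.fst]
    [ContractibleSpace P.snd] (x : (relHomology (k + 2)).obj P) : x = 0 := by
  obtain ⟨y, rfl⟩ := exists_absToRel_eq (absHomology_eq_zero (X := P.snd) ((connecting _ P).hom x))
  rw [absHomology_eq_zero (X := P.fst) y, map_zero]

/-- The pair `(X, {q})`. -/
abbrev ptPair (q : X) : TopPair.{0} := TopPair.ofSubset (X := TopCat.of X) {q}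

/-- A point has no homology in degrees `k + 1` and `k + 2`, so the map from absolute to relative
homology is bijective. -/
lemma isFreeGenerator_absToRel {k : ℕ} (q : X) {g : (absHomology (k + 2)).obj (TopCat.of X)}
    (hg : IsFreeGenerator g) : IsFreeGenerator ((absToRel (k + 2) (ptPair q)).hom g) := by
  refine ⟨fun x => ?_, fun a ha => hg.2 a ?_⟩
  · obtain ⟨y, rfl⟩ := exists_absToRel_eq
      (absHomology_eq_zero (X := ({q} : Set X)) ((connecting _ (ptPair q)).hom x))
    obtain ⟨a, rfl⟩ := hg.1 y
    exact ⟨a, map_zsmul _ _ _⟩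
  · obtain ⟨y, hy⟩ := exists_map_eq ((map_zsmul (absToRel (k + 2) (ptPair q)).hom a g).trans ha)
    rw [← hy, absHomology_eq_zero (X := ({q} : Set X)) y]
    exact map_zero _

end SingularHomology

variable {n : ℕ}

/-! ### The geometry of the disc bundle -/

instance contractibleSpace_fibre (p : S n) : ContractibleSpace (Fibre p) := by
  rw [contractible_iff_id_nullhomotopic]
  refine ⟨⟨⟨(p.1, 0), p.2, by simp, by simp⟩, rfl⟩, ⟨
    { toFun := fun q => ⟨⟨(q.2.1.1.1, (1 - q.1.1) • q.2.1.1.2), q.2.1.2.1, by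
        rw [inner_smul_right, q.2.1.2.2.1, mul_zero], by
        rw [norm_smul, Real.norm_of_nonneg (by linarith [q.1.2.2])]
        nlinarith [q.1.2.1, q.1.2.2, q.2.1.2.2.2, norm_nonneg q.2.1.1.2]⟩, q.2.2⟩
      continuous_toFun := by fun_prop
      map_zero_left := fun x => ?_
      map_one_left := fun x => ?_ }⟩⟩
  · apply Subtype.ext
    apply Subtype.ext
    change (x.1.1.1, (1 - (0 : ℝ)) • x.1.1.2) = x.1.1
    rw [sub_zero, one_smul]
  · apply Subtype.ext
    apply Subtype.ext
    change (x.1.1.1, (1 - (1 : ℝ)) • x.1.1.2) = (p.1, 0)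
    rw [sub_self, zero_smul, x.2]

lemma inner_fibre (p : S n) (x : Fibre p) : inner ℝ p.1 x.1.1.2 = 0 :=
  (congrArg (inner ℝ · x.1.1.2) x.2).symm.trans x.1.2.2.1

/-- The boundary of the fibre of the disc bundle. -/
abbrev FibreBoundary (p : S n) : Set (Fibre p) := {x | ‖x.1.1.2‖ = 1}

lemma isHomologySphere_fibreBoundary (p : S (n + 1)) :
    IsHomologySphere n (FibreBoundary p) := by
  have hp : p.1 ≠ 0 := fun h => by simpa [h] using p.2
  have : Fact (Module.finrank ℝ (E (n + 1)) = n + 1 + 1) := ⟨by simp⟩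
  have h := isHomologySphere_USphere n (Submodule.span ℝ {p.1})ᗮ
    (Submodule.finrank_orthogonal_span_singleton hp)
  let f : C(USphere (Submodule.span ℝ {p.1})ᗮ, FibreBoundary p) :=
    ⟨fun y => ⟨⟨⟨(p.1, y.1.1), p.2, Submodule.mem_orthogonal_singleton_iff_inner_right.1 y.1.2,
      le_of_eq y.2⟩, rfl⟩, y.2⟩, by fun_prop⟩
  let g : C(FibreBoundary p, USphere (Submodule.span ℝ {p.1})ᗮ) :=
    ⟨fun x => ⟨⟨x.1.1.1.2, Submodule.mem_orthogonal_singleton_iff_inner_right.2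
      (inner_fibre p x.1)⟩, x.2⟩, by fun_prop⟩
  refine h.of_homotopyEquiv f g (ContinuousMap.Homotopic.refl _) ?_
  have : f.comp g = ContinuousMap.id _ := by
    ext1 x
    apply Subtype.ext
    apply Subtype.ext
    apply Subtype.ext
    exact Prod.ext x.1.2.symm rfl
  rw [this]

/-- The bundle projection of `T^*S^n`. -/
def cotProj : C(T n, S n) := ⟨fun x => ⟨x.1.1, x.2.1⟩, by fun_prop⟩

/-- The zero section of `T^*S^n`. -/
def cotZero : C(S n, T n) := ⟨fun u => ⟨(u.1, 0), u.2, by simp⟩, by fun_prop⟩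

lemma cotZero_comp_cotProj_homotopic : (cotZero.comp cotProj).Homotopic (ContinuousMap.id (T n)) :=
  ⟨{ toFun := fun q => ⟨(q.2.1.1, q.1.1 • q.2.1.2), q.2.2.1, by
        rw [inner_smul_right, q.2.2.2, mul_zero]⟩
     continuous_toFun := by fun_prop
     map_zero_left := fun x => Subtype.ext (Prod.ext rfl (zero_smul ℝ x.1.2))
     map_one_left := fun x => Subtype.ext (Prod.ext rfl (one_smul ℝ x.1.2)) }⟩

/-- The bundle projection of `D^*(S^n)`. -/
def discProj : C(D n, S n) := ⟨fun x => ⟨x.1.1, x.2.1⟩, by fun_prop⟩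

/-- The zero section of `D^*(S^n)` as a continuous map. -/
abbrev discZero (n : ℕ) : C(S n, D n) := (zeroSection n).hom

lemma discZero_comp_discProj_homotopic :
    ((discZero n).comp discProj).Homotopic (ContinuousMap.id (D n)) :=
  ⟨{ toFun := fun q => ⟨(q.2.1.1, q.1.1 • q.2.1.2), q.2.2.1, by
        rw [inner_smul_right, q.2.2.2.1, mul_zero], by
        rw [norm_smul, Real.norm_of_nonneg q.1.2.1]
        exact mul_le_one₀ q.1.2.2 (norm_nonneg _) q.2.2.2.2⟩
     continuous_toFun := by fun_prop
     map_zero_left := fun x => Subtype.ext (Prod.ext rfl (zero_smul ℝ x.1.2))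
     map_one_left := fun x => Subtype.ext (Prod.ext rfl (one_smul ℝ x.1.2)) }⟩

/-- The bundle projection as a map of pairs `(D^*(S^n), B) → (S^n, {p})`. -/
def projPair (p : S n) : discPair p ⟶ ptPair p :=
  TopPair.ofHom (X := discPair p) (Y := ptPair p) (TopCat.ofHom discProj)
    (TopCat.ofHom ⟨fun x => ⟨discProj x.1, Subtype.ext x.2.1⟩, by fun_prop⟩) rfl

/-- The map `wrapFun` as a map of pairs `(D^*(S^n), B) → (S^n, {-p})`. -/
def wrapDiscPair (p : S n) : discPair p ⟶ spherePair p :=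
  TopPair.ofHom (X := discPair p) (Y := spherePair p)
    (TopCat.ofHom ⟨fun x => ⟨wrapFun x, norm_wrapFun x⟩, by unfold wrapFun; fun_prop⟩)
    (TopCat.ofHom ⟨fun x => ⟨⟨wrapFun x.1, norm_wrapFun x.1⟩,
      wrapFun_boundary p ⟨x.1, x.2.1⟩ x.2.2⟩, by unfold wrapFun; fun_prop⟩) rfl

/-- The antipodal map as a map of pairs `(S^n, {-p}) → (S^n, {p})`. -/
def antipPair (p : S n) : spherePair p ⟶ ptPair p :=
  TopPair.ofHom (X := spherePair p) (Y := ptPair p) (TopCat.ofHom (antip n))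
    (TopCat.ofHom ⟨fun x => ⟨antip n x.1, by
      rw [x.2]
      exact Subtype.ext (neg_neg p.1)⟩, by fun_prop⟩) rfl

/-- The pair consisting of twice a one-point space. -/
abbrev unitPair : TopPair.{0} := TopPair.of (𝟙 (TopCat.of Unit)) Topology.IsEmbedding.id

/-- The projection is constant on the fibre, hence factors through a pair of points with vanishing
relative homology. -/
lemma projPair_fibreClass {n : ℕ} (p : S (n + 2)) (δ : (relHomology (n + 2)).obj (fibrePair p)) :
    ((relHomology (n + 2)).map (projPair p)).hom (fibreClass p δ) = 0 := by
  let a : fibrePair p ⟶ unitPair :=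
    TopPair.ofHom (X := fibrePair p) (Y := unitPair) (TopCat.ofHom (toPt _)) (TopCat.ofHom (toPt _))
      rfl
  let b : unitPair ⟶ ptPair p :=
    TopPair.ofHom (X := unitPair) (Y := ptPair p) (TopCat.ofHom (ContinuousMap.const Unit p))
      (TopCat.ofHom (ContinuousMap.const Unit ⟨p, rfl⟩)) rfl
  have hab : fibreIncl p ≫ projPair p = a ≫ b := by
    ext x
    · exact Subtype.ext (Subtype.ext x.1.2)
    · exact Subtype.ext x.2
  have : ContractibleSpace unitPair.fst := inferInstanceAs (ContractibleSpace Unit)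
  have : ContractibleSpace unitPair.snd := inferInstanceAs (ContractibleSpace Unit)
  rw [fibreClass, relHomology_map_map, hab, ← relHomology_map_map,
    relHomology_eq_zero (((relHomology (n + 2)).map a).hom δ), map_zero]

/-! ### A disc in the boundary of the disc bundle -/

/-- For `v` in the fibre over `p`, the unit normal vector `v + √(1 - |v|²) p`. -/
def hemi (p : S n) (x : Fibre p) : E n := x.1.1.2 + √(1 - ‖x.1.1.2‖ ^ 2) • p.1

lemma sq_sqrt_fibre (p : S n) (x : Fibre p) :
    √(1 - ‖x.1.1.2‖ ^ 2) ^ 2 = 1 - ‖x.1.1.2‖ ^ 2 :=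
  Real.sq_sqrt (by nlinarith [norm_nonneg x.1.1.2, x.1.2.2.2])

lemma norm_hemi (p : S n) (x : Fibre p) : ‖hemi p x‖ = 1 := by
  have : ‖hemi p x‖ ^ 2 = 1 := by
    rw [hemi, norm_add_sq_real, inner_smul_right, real_inner_comm, inner_fibre, norm_smul, p.2,
      mul_one, Real.norm_eq_abs, sq_abs, sq_sqrt_fibre]
    ring
  nlinarith [norm_nonneg (hemi p x)]

lemma inner_hemi (p : S n) (x : Fibre p) : inner ℝ (hemi p x) p.1 = √(1 - ‖x.1.1.2‖ ^ 2) := by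
  rw [hemi, inner_add_left, inner_smul_left, real_inner_comm, inner_fibre,
    real_inner_self_eq_norm_sq, p.2]
  simp

/-- This links the two coordinates: the reflected base point is the antipode of `wrapFun`, so the
degree of the antipodal map enters in one of them only. -/
lemma reflect_hemi (p : S n) (x : Fibre p) :
    p.1 - (2 * inner ℝ (hemi p x) p.1) • hemi p x = -wrapFun x.1 := by
  have h : (2 * √(1 - ‖x.1.1.2‖ ^ 2)) * √(1 - ‖x.1.1.2‖ ^ 2) = 2 * (1 - ‖x.1.1.2‖ ^ 2) := by
    linear_combination 2 * sq_sqrt_fibre p x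
  rw [inner_hemi, hemi, smul_add, smul_smul, h, wrapFun, x.2]
  module

lemma inner_reflect {F : Type} [NormedAddCommGroup F] [InnerProductSpace ℝ F] {m : F}
    (hm : ‖m‖ = 1) (x y : F) :
    inner ℝ (x - (2 * inner ℝ m x) • m) (y - (2 * inner ℝ m y) • m) = inner ℝ x y := by
  simp only [inner_sub_left, inner_sub_right, inner_smul_left, inner_smul_right,
    real_inner_self_eq_norm_sq, hm, real_inner_comm x m]
  simp
  ring

/-- The map of the fibre over `p` to the unit sphere bundle obtained by reflecting the pair
`(p, e)` in the hyperplanes orthogonal to the vectors `hemi p x`. -/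
def blowFun (p : S n) (e : E n) (he : ‖e‖ = 1) (hpe : inner ℝ p.1 e = 0) (x : Fibre p) : D n :=
  ⟨(p.1 - (2 * inner ℝ (hemi p x) p.1) • hemi p x, e - (2 * inner ℝ (hemi p x) e) • hemi p x),
    by rw [norm_sub_two_inner_smul (norm_hemi p x), p.2],
    by rw [inner_reflect (norm_hemi p x), hpe],
    by rw [norm_sub_two_inner_smul (norm_hemi p x), he]⟩

lemma norm_blowFun (p : S n) (e : E n) (he : ‖e‖ = 1) (hpe : inner ℝ p.1 e = 0) (x : Fibre p) :
    ‖(blowFun p e he hpe x).1.2‖ = 1 :=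
  (norm_sub_two_inner_smul (norm_hemi p x) e).trans he

lemma blowFun_mem (p : S n) (e : E n) (he : ‖e‖ = 1) (hpe : inner ℝ p.1 e = 0) (x : Fibre p)
    (hx : ‖x.1.1.2‖ = 1) : blowFun p e he hpe x ∈ fibreSphere p := by
  refine ⟨?_, norm_blowFun p e he hpe x⟩
  -- On the boundary of the fibre the normal vector is orthogonal to `p`, so the reflection fixes
  -- `p`.
  change p.1 - (2 * inner ℝ (hemi p x) p.1) • hemi p x = p.1
  rw [inner_hemi, hx]
  simp

lemma continuous_blowFun (p : S n) (e : E n) (he : ‖e‖ = 1) (hpe : inner ℝ p.1 e = 0) :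
    Continuous (blowFun p e he hpe) := by
  unfold blowFun hemi
  fun_prop

/-- The map `blowFun` as a map of pairs `(D, ∂D) → (D^*(S^n), B)`. -/
def blowPair (p : S n) (e : E n) (he : ‖e‖ = 1) (hpe : inner ℝ p.1 e = 0) :
    fibrePair p ⟶ discPair p :=
  TopPair.ofHom (X := fibrePair p) (Y := discPair p)
    (TopCat.ofHom ⟨blowFun p e he hpe, continuous_blowFun p e he hpe⟩)
    (TopCat.ofHom ⟨fun x => ⟨blowFun p e he hpe x.1, blowFun_mem p e he hpe x.1 x.2⟩,
      ((continuous_blowFun p e he hpe).comp continuous_subtype_val).subtype_mk _⟩) rfl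

/-- The disc lies in the unit sphere bundle, where the extension is the identity by construction.
This is where compact support is felt. -/
lemma blowPair_comp_extPair (p : S n) (e : E n) (he : ‖e‖ = 1) (hpe : inner ℝ p.1 e = 0)
    (f : HAutC n) : blowPair p e he hpe ≫ extPair p f = blowPair p e he hpe := by
  ext x
  · rfl
  · exact if_neg (not_lt.2 (norm_blowFun p e he hpe x).ge)

lemma blowPair_comp_projPair (p : S n) (e : E n) (he : ‖e‖ = 1) (hpe : inner ℝ p.1 e = 0) :
    blowPair p e he hpe ≫ projPair p = wrapPair p ≫ antipPair p := by
  ext x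
  · exact Subtype.ext (Subtype.ext (reflect_hemi p x.1))
  · exact Subtype.ext (reflect_hemi p x)

/-- On unit covectors `wrapFun` is the antipode of the base point, which cancels the sign in
`reflect_hemi`. -/
lemma wrapFun_blowFun (p : S n) (e : E n) (he : ‖e‖ = 1) (hpe : inner ℝ p.1 e = 0)
    (x : Fibre p) : wrapFun (blowFun p e he hpe x) = wrapFun x.1 := by
  have h : (blowFun p e he hpe x).1.1 = -wrapFun x.1 := reflect_hemi p x
  rw [wrapFun, norm_blowFun, h]
  norm_num

lemma blowPair_comp_wrapDiscPair (p : S n) (e : E n) (he : ‖e‖ = 1) (hpe : inner ℝ p.1 e = 0) :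
    blowPair p e he hpe ≫ wrapDiscPair p = wrapPair p := by
  ext x
  · exact Subtype.ext (Subtype.ext (wrapFun_blowFun p e he hpe x.1))
  · exact Subtype.ext (wrapFun_blowFun p e he hpe x)

/-! ### The action on homology -/

/-- Writing g' = cg and g = dg' gives dc = 1, so `c` is nonzero and g' has infinite order. -/
lemma IsFreeGenerator.of_generates {M : Type} [AddCommGroup M] {g g' : M} (hg : IsFreeGenerator g)
    (h : ∀ x : M, ∃ a : ℤ, x = a • g') : IsFreeGenerator g' := by
  refine ⟨h, fun a ha => ?_⟩
  obtain ⟨c, hc⟩ := hg.1 g'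
  obtain ⟨d, hd⟩ := h g
  have h1 : d * c - 1 = 0 := hg.2 _ (by rw [sub_smul, one_smul, mul_smul, ← hc, ← hd, sub_self])
  have h2 : a * c = 0 := hg.2 _ (by rw [mul_smul, ← hc, ha])
  rcases mul_eq_zero.1 h2 with h3 | h3
  · exact h3
  · rw [h3] at h1
    norm_num at h1

lemma IsFreeGenerator.eq_of_smul_eq {M : Type} [AddCommGroup M] {g : M} (hg : IsFreeGenerator g)
    {a b : ℤ} (h : a • g = b • g) : a = b :=
  sub_eq_zero.1 (hg.2 _ (by rw [sub_smul, h, sub_self]))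

lemma IsFundamentalClass.isFreeGenerator
    {σ : (absHomology (n + 1)).obj (TopCat.of (S (n + 1)))} (hσ : IsFundamentalClass σ) :
    IsFreeGenerator σ := by
  obtain ⟨g, hg⟩ := (isHomologySphere_USphere (n + 1) (E (n + 1)) (by simp)).exists_isFreeGenerator
  refine hg.of_generates fun x => ?_
  obtain ⟨a, ha⟩ := Submodule.mem_span_singleton.1
    ((show Submodule.span ℤ {σ} = ⊤ from hσ) ▸ Submodule.mem_top (x := x))
  exact ⟨a, ha.symm.trans (int_smul_eq_zsmul _ a σ)⟩

/-- The class of `(X, {q})` given by a class of `X`. -/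
def pointedClass {X : Type} [TopologicalSpace X] {k : ℕ} (q : X)
    (g : (absHomology k).obj (TopCat.of X)) : (relHomology k).obj (ptPair q) :=
  (absToRel k (ptPair q)).hom g

lemma IsFreeGenerator.pointedClass {X : Type} [TopologicalSpace X] {k : ℕ} (q : X)
    {g : (absHomology (k + 2)).obj (TopCat.of X)} (hg : IsFreeGenerator g) :
    IsFreeGenerator (pointedClass q g) :=
  isFreeGenerator_absToRel q hg

variable {p : S (n + 2)} {σ : (absHomology (n + 2)).obj (TopCat.of (S (n + 2)))}
  {δ : (relHomology (n + 2)).obj (fibrePair p)}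

/-- Let γ generate the homology of the fibre modulo its boundary and write δ = cγ. Since `wrapPair`
sends δ to ± a free generator, c divides ±1, so δ generates too. The degree of `wrapPair` need not
be computed. -/
lemma exists_eq_zsmul_connecting (hσ : IsFreeGenerator σ) (hδ : IsDualFibreClass p σ δ)
    (y : (absHomology (n + 1)).obj (fibrePair p).snd) :
    ∃ a : ℤ, y = a • (connecting (n + 1) (fibrePair p)).hom δ := by
  obtain ⟨g, hg⟩ := (isHomologySphere_fibreBoundary p).exists_isFreeGenerator
  obtain ⟨γ, hγ⟩ := exists_connecting_eq (P := fibrePair p) (x := g)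
    (absHomology_eq_zero (X := Fibre p) _)
  have hs := hσ.pointedClass (antipode p)
  obtain ⟨c, hc⟩ : ∃ c : ℤ, δ = c • γ := by
    obtain ⟨c, hc⟩ := hg.1 ((connecting (n + 1) (fibrePair p)).hom δ)
    refine ⟨c, sub_eq_zero.1 ?_⟩
    obtain ⟨x, hx⟩ := exists_absToRel_eq (P := fibrePair p) (x := δ - c • γ) (by
      rw [map_sub, map_zsmul, hγ, hc]
      exact sub_self _)
    rw [← hx, absHomology_eq_zero (X := Fibre p) x]
    exact map_zero _
  obtain ⟨d, hd⟩ := hs.1 (((relHomology (n + 2)).map (wrapPair p)).hom γ)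
  have h1 : c * d = (-1) ^ ((n + 2) / 2) := by
    refine hs.eq_of_smul_eq ?_
    rw [mul_smul, ← hd, ← map_zsmul, ← hc]
    exact hδ
  have h2 : c * c = 1 := by
    have : IsUnit c := isUnit_of_mul_isUnit_left (y := d) (by
      rw [h1]
      exact (IsUnit.neg isUnit_one).pow _)
    exact Int.isUnit_mul_self this
  obtain ⟨a, ha⟩ := hg.1 y
  refine ⟨a * c, ?_⟩
  rw [hc, map_zsmul, hγ]
  have h3 : a • g = (a * c) • c • g := by rw [smul_smul, mul_assoc, h2, mul_one]
  exact ha.trans h3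

/-- A multiple of the fibre class accounts for the boundary of `x` in B; the remainder comes from
absolute homology of the disc bundle, which retracts to the zero section. -/
lemma exists_eq_zeroSectionClass_add_fibreClass (hσ : IsFreeGenerator σ)
    (hδ : IsDualFibreClass p σ δ) (x : Hn p) :
    ∃ a b : ℤ, x = a • zeroSectionClass p σ + b • fibreClass p δ := by
  -- The boundary of the fibre and B are the same sphere as two different subtypes; `i` and `j`
  -- identify them.
  let i : C(FibreBoundary p, fibreSphere p) := ⟨fun x => ⟨x.1.1, x.1.2, x.2⟩, by fun_prop⟩
  let j : C(fibreSphere p, FibreBoundary p) := ⟨fun x => ⟨⟨x.1, x.2.1⟩, x.2.2⟩, by fun_prop⟩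
  let y : (absHomology (n + 1)).obj (TopCat.of (fibreSphere p)) :=
    (connecting (n + 1) (discPair p)).hom x
  obtain ⟨b, hb⟩ := exists_eq_zsmul_connecting hσ hδ
    (((absHomology (n + 1)).map (TopCat.ofHom j)).hom y)
  have h1 : y = b • (connecting (n + 1) (discPair p)).hom (fibreClass p δ) := by
    have h2 := ((absHomology_map_map j i y).symm.trans
      (congrArg ((absHomology (n + 1)).map (TopCat.ofHom i)).hom hb)).trans (map_zsmul _ b _)
    refine (absHomology_map_id y).symm.trans (h2.trans ?_)
    rw [fibreClass, connecting_map]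
    rfl
  obtain ⟨u, hu⟩ : ∃ u : (absHomology (n + 2)).obj (TopCat.of (D (n + 2))),
      (absToRel (n + 2) (discPair p)).hom u = x - b • fibreClass p δ :=
    exists_absToRel_eq (P := discPair p) (by
      rw [map_sub, map_zsmul, ← h1]
      exact sub_self _)
  obtain ⟨a, ha⟩ := hσ.1 (((absHomology (n + 2)).map (TopCat.ofHom discProj)).hom u)
  refine ⟨a, b, ?_⟩
  have h3 : u = a • ((absHomology (n + 2)).map (zeroSection (n + 2))).hom σ := by
    refine (absHomology_map_id u).symm.trans ?_
    rw [← absHomology_map_eq discZero_comp_discProj_homotopic, ← absHomology_map_map, ha, map_zsmul]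
    rfl
  rw [h3] at hu
  exact sub_eq_iff_eq_add.1 (hu.symm.trans (map_zsmul _ a _))

lemma projPair_zeroSectionClass :
    ((relHomology (n + 2)).map (projPair p)).hom (zeroSectionClass p σ) =
      pointedClass p σ := by
  have h := absToRel_map (projPair p) (((absHomology (n + 2)).map (zeroSection (n + 2))).hom σ)
  refine h.trans (congrArg _ ?_)
  exact (absHomology_map_map (discZero (n + 2)) discProj σ).trans (absHomology_map_id σ)

lemma wrapDiscPair_zeroSectionClass :
    ((relHomology (n + 2)).map (wrapDiscPair p)).hom (zeroSectionClass p σ) =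
      pointedClass (antipode p) σ := by
  have h := absToRel_map (wrapDiscPair p) (((absHomology (n + 2)).map (zeroSection (n + 2))).hom σ)
  refine h.trans (congrArg _ ?_)
  refine (absHomology_map_map (discZero (n + 2)) _ σ).trans ?_
  refine Eq.trans (congrArg (fun f => ((absHomology (n + 2)).map (TopCat.ofHom f)).hom σ) ?_)
    (absHomology_map_id σ)
  ext1 u
  apply Subtype.ext
  change (1 - 2 * ‖(0 : E (n + 2))‖ ^ 2) • u.1 + (2 * √(1 - ‖(0 : E (n + 2))‖ ^ 2)) • 0 = u.1
  simp

lemma wrapDiscPair_fibreClass (hδ : IsDualFibreClass p σ δ) :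
    ((relHomology (n + 2)).map (wrapDiscPair p)).hom (fibreClass p δ) =
      (-1 : ℤ) ^ ((n + 2) / 2) • pointedClass (antipode p) σ := by
  rw [fibreClass, relHomology_map_map]
  exact hδ

/-- In the two coordinates the matrix is triangular with diagonal 1 and ±1: the projection kills the
fibre class and isolates `a`, then `wrapFun` detects `b`. -/
lemma zeroSectionClass_fibreClass_independent (hσ : IsFreeGenerator σ)
    (hδ : IsDualFibreClass p σ δ) (a b : ℤ)
    (h : a • zeroSectionClass p σ + b • fibreClass p δ = 0) : a = 0 ∧ b = 0 := by
  have h1 := congrArg ((relHomology (n + 2)).map (projPair p)).hom h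
  rw [map_add, map_zsmul, map_zsmul, projPair_zeroSectionClass, projPair_fibreClass, zsmul_zero,
    add_zero, map_zero] at h1
  obtain rfl := (hσ.pointedClass p).2 a h1
  have h2 := congrArg ((relHomology (n + 2)).map (wrapDiscPair p)).hom h
  rw [zero_smul, zero_add, map_zsmul, wrapDiscPair_fibreClass hδ, map_zero, smul_smul] at h2
  have h3 := (hσ.pointedClass (antipode p)).2 _ h2
  exact ⟨rfl, (mul_eq_zero.1 h3).resolve_right (pow_ne_zero _ (by norm_num))⟩

/-- The zero section generates the homology of T^*S^n, an infinite cyclic group on which a homotopy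
equivalence acts by a unit. -/
lemma exists_extPair_zeroSectionClass (hσ : IsFreeGenerator σ) (f : HAutC (n + 2)) :
    ∃ e : ℤ, (e = 1 ∨ e = -1) ∧ ((relHomology (n + 2)).map (extPair p f)).hom
      (zeroSectionClass p σ) = e • zeroSectionClass p σ := by
  let t := ((absHomology (n + 2)).map (TopCat.ofHom (cotZero (n := n + 2)))).hom σ
  have key (g : C(T (n + 2), T (n + 2))) : ∃ e : ℤ,
      ((absHomology (n + 2)).map (TopCat.ofHom g)).hom t = e • t := by
    obtain ⟨e, he⟩ := hσ.1 (((absHomology (n + 2)).map (TopCat.ofHom cotProj)).hom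
      (((absHomology (n + 2)).map (TopCat.ofHom g)).hom t))
    refine ⟨e, ?_⟩
    refine (absHomology_map_id _).symm.trans ?_
    rw [← absHomology_map_eq cotZero_comp_cotProj_homotopic, ← absHomology_map_map, he, map_zsmul]
  have ht (a : ℤ) (h : a • t = t) : a = 1 := by
    have h1 := congrArg ((absHomology (n + 2)).map (TopCat.ofHom cotProj)).hom h
    have h2 : ((absHomology (n + 2)).map (TopCat.ofHom cotProj)).hom t = σ :=
      (absHomology_map_map cotZero cotProj σ).trans (absHomology_map_id σ)
    rw [map_zsmul, h2] at h1
    exact hσ.eq_of_smul_eq (h1.trans (one_smul ℤ σ).symm)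
  obtain ⟨h, hh⟩ := f.homotopyEquiv
  obtain ⟨e, he⟩ := key f.toMap
  obtain ⟨e', he'⟩ := key h.invFun
  have hee : e * e' = 1 := by
    refine ht _ ?_
    rw [mul_smul, ← he', ← map_zsmul, ← he, absHomology_map_map, ← hh,
      absHomology_map_eq h.left_inv, absHomology_map_id]
  refine ⟨e, Int.isUnit_iff.1 (IsUnit.of_mul_eq_one _ hee), ?_⟩
  have h1 := absToRel_map (extPair p f) (((absHomology (n + 2)).map (zeroSection (n + 2))).hom σ)
  refine h1.trans ?_
  have h0 (c : ℝ) : c • (0 : E (n + 2)) = 0 := smul_zero c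
  let F : C(D (n + 2), D (n + 2)) := ⟨extFun f.toMap, continuous_extFun' f⟩
  let τ : C(T (n + 2), D (n + 2)) := ⟨toDisc, continuous_toDisc⟩
  -- The zero section lies in the interior, where the extension is `f` itself up to `toDisc`.
  have e1 : F.comp (discZero (n + 2)) = τ.comp (f.toMap.comp cotZero) := by
    ext1 u
    have h2 : ofDisc (discZero (n + 2) u) = cotZero u := Subtype.ext (Prod.ext rfl (h0 _))
    have h3 : ‖(discZero (n + 2) u).1.2‖ < 1 := by
      change ‖(0 : E (n + 2))‖ < 1
      simp
    exact (if_pos h3).trans (congrArg (fun x => toDisc (f.toMap x)) h2)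
  have e2 : τ.comp cotZero = discZero (n + 2) := by
    ext1 u
    exact Subtype.ext (Prod.ext rfl (h0 _))
  have e3 : ((absHomology (n + 2)).map (TopCat.ofHom F)).hom
      (((absHomology (n + 2)).map (zeroSection (n + 2))).hom σ) =
      e • ((absHomology (n + 2)).map (zeroSection (n + 2))).hom σ := by
    refine (absHomology_map_map (discZero (n + 2)) F σ).trans ?_
    rw [e1, ← absHomology_map_map, ← absHomology_map_map, he, map_zsmul, absHomology_map_map, e2]
    rfl
  exact (congrArg (absToRel (n + 2) (discPair p)).hom e3).trans (map_zsmul _ _ _)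

/-- The class is the image of δ under `blowPair`. Its coefficients are found by comparing the
projection and `wrapFun` coordinates, and invariance holds because the disc is fixed pointwise. -/
lemma exists_blowPair_class (hn : Even n) (hσ : IsFreeGenerator σ) (hδ : IsDualFibreClass p σ δ) :
    ∃ G : Hn p, G = (-(-1 : ℤ) ^ ((n + 2) / 2)) • zeroSectionClass p σ + (2 : ℤ) • fibreClass p δ ∧
      ∀ f : HAutC (n + 2), ((relHomology (n + 2)).map (extPair p f)).hom G = G := by
  have hp : p.1 ≠ 0 := fun h => by simpa [h] using p.2
  have : Fact (Module.finrank ℝ (E (n + 2)) = n + 2 + 1) := ⟨by simp⟩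
  have : Nontrivial (Submodule.span ℝ {p.1})ᗮ := Module.nontrivial_of_finrank_pos (R := ℝ) (by
    rw [Submodule.finrank_orthogonal_span_singleton (n := n + 2) hp]
    omega)
  obtain ⟨⟨e, hpe⟩, he⟩ := exists_norm_eq (Submodule.span ℝ {p.1})ᗮ zero_le_one
  have hpe : inner ℝ p.1 e = 0 := Submodule.mem_orthogonal_singleton_iff_inner_right.1 hpe
  have he : ‖e‖ = 1 := he
  let G : Hn p := ((relHomology (n + 2)).map (blowPair p e he hpe)).hom δ
  refine ⟨G, ?_, fun f => ?_⟩
  · obtain ⟨x, y, hxy⟩ := exists_eq_zeroSectionClass_add_fibreClass hσ hδ G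
    have h1 : ((relHomology (n + 2)).map (projPair p)).hom G =
        (-(-1 : ℤ) ^ ((n + 2) / 2)) • pointedClass p σ := by
      have h : ((relHomology (n + 2)).map (wrapPair p)).hom δ =
        (-1 : ℤ) ^ ((n + 2) / 2) • pointedClass (antipode p) σ := hδ
      have h' : ((relHomology (n + 2)).map (antipPair p)).hom (pointedClass (antipode p) σ) =
          -pointedClass p σ :=
        (absToRel_map (antipPair p) σ).trans
          ((congrArg _ (absHomology_map_antip (n + 2) (hn.add even_two) σ)).trans (map_neg _ _))
      rw [relHomology_map_map, blowPair_comp_projPair, ← relHomology_map_map, h, map_zsmul, h',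
        zsmul_neg, neg_zsmul]
    have h2 : ((relHomology (n + 2)).map (wrapDiscPair p)).hom G =
        (-1 : ℤ) ^ ((n + 2) / 2) • pointedClass (antipode p) σ := by
      rw [relHomology_map_map, blowPair_comp_wrapDiscPair]
      exact hδ
    rw [hxy, map_add, map_zsmul, map_zsmul, projPair_zeroSectionClass, projPair_fibreClass,
      zsmul_zero, add_zero] at h1
    have hx := (hσ.pointedClass p).eq_of_smul_eq h1
    rw [hxy, map_add, map_zsmul, map_zsmul, wrapDiscPair_zeroSectionClass,
      wrapDiscPair_fibreClass hδ, smul_smul, ← add_zsmul] at h2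
    have hy := (hσ.pointedClass (antipode p)).eq_of_smul_eq h2
    have hε : (-1 : ℤ) ^ ((n + 2) / 2) ≠ 0 := pow_ne_zero _ (by norm_num)
    -- The `wrapFun` coordinate reads x + yε = ε; with x = -ε this leaves y = 2.
    have hy2 : y = 2 := by
      refine mul_right_cancel₀ hε ?_
      rw [hx] at hy
      linarith
    rw [hxy, hx, hy2]
  · rw [relHomology_map_map, blowPair_comp_extPair]

/-- If φ y = ax + by, comparing coefficients in the fixed vector gives -εe + 2a = -ε and 2b = 2. So
b = 1, with a = 0 for e = 1 and a = -ε for e = -1. -/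
lemma eq_or_eq_neg_of_fixed {M : Type} [AddCommGroup M] {x y : M} {ε e : ℤ}
    (hind : ∀ a b : ℤ, a • x + b • y = 0 → a = 0 ∧ b = 0)
    (hspan : ∀ u, ∃ a b : ℤ, u = a • x + b • y) (φ : M →+ M) (he : e = 1 ∨ e = -1)
    (hx : φ x = e • x) (hfix : φ (-ε • x + (2 : ℤ) • y) = -ε • x + (2 : ℤ) • y) :
    (φ x = x ∧ φ y = y) ∨ (φ x = -x ∧ φ y = y - ε • x) := by
  obtain ⟨a, b, hy⟩ := hspan (φ y)
  rw [map_add, map_zsmul, map_zsmul, hx, hy, ← sub_eq_zero] at hfix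
  obtain ⟨h2, h3⟩ := hind (-ε * e + 2 * a + ε) (2 * b - 2) (by
    rw [← hfix]
    module)
  obtain rfl : b = 1 := by linarith
  rw [hx, hy]
  rcases he with rfl | rfl
  · obtain rfl : a = 0 := by linarith
    left
    constructor <;> module
  · obtain rfl : a = -ε := by linarith
    right
    constructor <;> module

lemma extPair_zeroSectionClass_fibreClass (hn : Even n) (hσ : IsFreeGenerator σ)
    (hδ : IsDualFibreClass p σ δ) (f : HAutC (n + 2)) :
    (((relHomology (n + 2)).map (extPair p f)).hom (zeroSectionClass p σ) = zeroSectionClass p σ ∧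
      ((relHomology (n + 2)).map (extPair p f)).hom (fibreClass p δ) = fibreClass p δ) ∨
    (((relHomology (n + 2)).map (extPair p f)).hom (zeroSectionClass p σ) =
        -zeroSectionClass p σ ∧
      ((relHomology (n + 2)).map (extPair p f)).hom (fibreClass p δ) =
        fibreClass p δ - ((-1 : ℤ) ^ ((n + 2) / 2)) • zeroSectionClass p σ) := by
  obtain ⟨G, hG, hfG⟩ := exists_blowPair_class hn hσ hδ
  obtain ⟨e, he, hS⟩ := exists_extPair_zeroSectionClass (p := p) hσ f
  exact eq_or_eq_neg_of_fixed (zeroSectionClass_fibreClass_independent hσ hδ)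
    (exists_eq_zeroSectionClass_add_fibreClass hσ hδ)
    ((relHomology (n + 2)).map (extPair p f)).hom.toAddMonoidHom he hS (hG ▸ hfG f)

lemma exists_basis_toMatrix {M ι : Type} [AddCommGroup M] {x y z : M} {ε : ℤ}
    (hind : ∀ a b : ℤ, a • x + b • y = 0 → a = 0 ∧ b = 0)
    (hspan : ∀ u, ∃ a b : ℤ, u = a • x + b • y) (hz : z = ε • x) [inst : Module ℤ M]
    (φ : ι → M →ₗ[ℤ] M)
    (hφ : ∀ i, (φ i x = x ∧ φ i y = y) ∨ (φ i x = -x ∧ φ i y = y - z)) :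
    ∃ b : Module.Basis (Fin 2) ℤ M, b 0 = x ∧ b 1 = y ∧ ∀ i,
      LinearMap.toMatrix b b (φ i) = 1 ∨ LinearMap.toMatrix b b (φ i) = !![-1, -ε; 0, 1] := by
  -- The ℤ-module structure from `ModuleCat` need not be the canonical one by definition, but
  -- ℤ-module structures are unique.
  obtain rfl : inst = AddCommGroup.toIntModule M := Subsingleton.elim _ _
  subst hz
  let b : Module.Basis (Fin 2) ℤ M := Module.Basis.mk (v := ![x, y])
    (LinearIndependent.pair_iff.2 hind) (fun u _ => by
      obtain ⟨a, b, rfl⟩ := hspan u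
      refine add_mem (Submodule.smul_mem _ _ (Submodule.subset_span ⟨0, rfl⟩))
        (Submodule.smul_mem _ _ (Submodule.subset_span ⟨1, rfl⟩)))
  have h0 : b 0 = x := by simp [b]
  have h1 : b 1 = y := by simp [b]
  refine ⟨b, h0, h1, fun i => (hφ i).imp (fun h => ?_) fun h => ?_⟩
  · have : φ i = LinearMap.id := b.ext fun j => by
      fin_cases j
      · simpa [h0] using h.1
      · simpa [h1] using h.2
    rw [this, LinearMap.toMatrix_id]
  · have e0 : φ i (b 0) = -b 0 := by rw [h0, h.1]
    have e1 : φ i (b 1) = b 1 - ε • b 0 := by rw [h1, h0, h.2]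
    ext r c
    rw [LinearMap.toMatrix_apply]
    fin_cases c
    · change b.repr (φ i (b 0)) r = _
      rw [e0]
      fin_cases r <;> simp
    · change b.repr (φ i (b 1)) r = _
      rw [e1]
      fin_cases r <;> simp

end CotSphere

end

theorem mainTheorem8 (n : ℕ) (hn : Even n) (hpos : 0 < n) (p : CotSphere.S n)
    (σ : (CotSphere.absHomology n).obj (TopCat.of (CotSphere.S n)))
    (hσ : CotSphere.IsFundamentalClass σ)
    (δ : (CotSphere.relHomology n).obj (CotSphere.fibrePair p))
    (hδ : CotSphere.IsDualFibreClass p σ δ) :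
    ∃ b : Module.Basis (Fin 2) ℤ (CotSphere.Hn p),
      b 0 = CotSphere.zeroSectionClass p σ ∧ b 1 = CotSphere.fibreClass p δ ∧
      ∀ a : CotSphere.PiZeroHAutC n,
        LinearMap.toMatrix b b (CotSphere.act p a) = 1 ∨
        LinearMap.toMatrix b b (CotSphere.act p a) = !![-1, (-1) ^ (n / 2 + 1); 0, 1] := by
  -- Positive and even means at least two, the range in which the point terms of the long exact
  -- sequences vanish.
  obtain ⟨m, rfl⟩ : ∃ m, n = m + 2 := ⟨n - 2, by obtain ⟨k, rfl⟩ := hn; omega⟩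
  have hm : Even m := (Nat.even_add.1 hn).2 even_two
  have hσ := hσ.isFreeGenerator
  -- Turns the matrix entry into -ε with ε = (-1)^(n/2).
  rw [pow_succ, mul_neg_one]
  refine CotSphere.exists_basis_toMatrix
    (CotSphere.zeroSectionClass_fibreClass_independent hσ hδ)
    (CotSphere.exists_eq_zeroSectionClass_add_fibreClass hσ hδ) rfl (CotSphere.act p) fun a => ?_
  induction a using Quotient.inductionOn with
  | h f => exact CotSphere.extPair_zeroSectionClass_fibreClass hm hσ hδ f
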